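/- Let $\Omega\subset\mathbb R^N$ be a bounded open set with $C^\infty$ boundary (locally, up to rotation, the strict subgraph of a smooth function), with outward unit normal $\nu$ and surface measure $\sigma$ on $\partial\Omega$, and let $\beta:\partial\Omega\to[0,\infty)$ be smooth. Let $D(\Delta_R)$ be the set of all $u\in H^1(\Omega)\cap C(\overline\Omega)$ with distributional Laplacian $\Delta u\in C(\overline\Omega)$ such that $$\int_\Omega\nabla u\cdot\nabla\varphi+\int_\Omega\Delta u\,\varphi+\int_{\partial\Omega}u\,\varphi\,\beta\,d\sigma=0\qquad\text{for all }\varphi\in H^1(\Omega)$$ (in the boundary integral $\varphi$ is the trace), and let $D=D(\Delta_R)\cap C^\infty(\overline\Omega)$; for $u\in C^\infty(\overline\Omega)$, membership $u\in D(\Delta_R)$ is the weak form of the Robin condition $\partial u/\partial\nu+\beta u=0$ on $\partial\Omega$. Let $C_0(\mathbb R^N)$ be the space of continuous functions on $\mathbb R^N$ vanishing at infinity and $$D(\Delta_0)=\{v\in C_0(\mathbb R^N):\Delta v\in C_0(\mathbb R^N)\}$$ with $\Delta$ in the sense of distributions. Let $\delta>0$ be such that $T(z,t)=z+t\,\nu(z)$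 is a smooth diffeomorphism from $\partial\Omega\times(-\delta,\delta)$ onto an open neighbourhood of $\partial\Omega$ in $\mathbb R^N$. Let $\rho_1\in C^\infty([0,\infty)\times[0,\infty))$ satisfy, for all $\gamma\ge0$: $0\le\rho_1(\gamma,t)\le1$ for $t\ge0$; $\rho_1(\gamma,t)=0$ for $t\ge\delta/2$; $\rho_1(\gamma,0)=1$; $\partial_t\rho_1(\gamma,0)=-2\gamma$; and $\partial_t^2\rho_1(\gamma,0)=4\gamma^2$. For $u\in C(\overline\Omega)$ define $E_\beta u:\mathbb R^N\to\mathbb R$ by $E_\beta u=u$ on $\overline\Omega$; $E_\beta u(x)=\rho_1(\beta(z),t)\,u(T(z,-t))$ if $x=T(z,t)\notin\overline\Omega$ with $z\in\partial\Omega$, $0\le t<\delta$; and $E_\beta u(x)=0$ for all other $x$. Then $E_\beta$ maps $D$ into $D(\Delta_0)$: for every $u\in D$, the function $E_\beta u$ is continuous on $\mathbb R^N$ and vanishes at infinity, and its distributional Laplacian is a continuous function on $\mathbb R^N$ vanishing at infinity. -/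

import Mathlib

open Set Filter Topology MeasureTheory
open scoped ContDiff InnerProductSpace Laplacian ZeroAtInfty ENNReal

noncomputable section

/-- The space `ℝ^N` with its Euclidean norm. -/
abbrev Euc (N : ℕ) : Type := EuclideanSpace ℝ (Fin N)

/-- `Ω` is a bounded open set with `C^∞` boundary: near every boundary point `x₀` it is, up to a
rotation, the strict subgraph of a smooth function. Here the unit vector `e` is the vertical
direction, and `g` is evaluated at the component of `x` orthogonal to `e`. -/
structure IsSmoothBoundedOpen {N : ℕ} (Ω : Set (Euc N)) : Prop where
  isOpen : IsOpen Ω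
  isBounded : Bornology.IsBounded Ω
  locally_subgraph : ∀ x₀ ∈ frontier Ω, ∃ (e : Euc N) (g : Euc N → ℝ) (V : Set (Euc N)),
    ‖e‖ = 1 ∧ ContDiff ℝ ∞ g ∧ IsOpen V ∧ x₀ ∈ V ∧
      ∀ x ∈ V, x ∈ Ω ↔ ⟪e, x⟫_ℝ < g (x - ⟪e, x⟫_ℝ • e)

/-- `n` is the outwards pointing unit normal of `Ω` at the boundary point `p`: it is a unit
vector, it is orthogonal to the velocity of every smooth curve in `∂Ω` through `p`, and it points
out of `Ω`. -/
structure IsOuterUnitNormal {N : ℕ} (Ω : Set (Euc N)) (p n : Euc N) : Prop where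
  norm_eq_one : ‖n‖ = 1
  orthogonal : ∀ ξ : ℝ → Euc N, ContDiff ℝ ∞ ξ → (∀ᶠ t in 𝓝 (0 : ℝ), ξ t ∈ frontier Ω) →
    ξ 0 = p → ⟪n, deriv ξ 0⟫_ℝ = 0
  outward : ∀ᶠ t in 𝓝[>] (0 : ℝ), p - t • n ∈ Ω ∧ p + t • n ∉ closure Ω

open Classical in
/-- The outwards pointing unit normal `ν` of `Ω` (with value `0` where there is none). -/
def outerNormal {N : ℕ} (Ω : Set (Euc N)) (p : Euc N) : Euc N :=
  if h : ∃ n, IsOuterUnitNormal Ω p n then h.choose else 0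

/-- The surface measure `σ` on `∂Ω`: the `(N-1)`-dimensional Hausdorff measure, normalized so that
it agrees with Lebesgue measure on `ℝ^(N-1)`. -/
def surfaceMeasure {N : ℕ} (Ω : Set (Euc N)) : Measure (Euc N) :=
  (Measure.euclideanHausdorffMeasure (N - 1)).restrict (frontier Ω)

/-- Test functions on `Ω`: smooth functions whose support is a compact subset of `Ω`. -/
structure IsTestFunction {N : ℕ} (Ω : Set (Euc N)) (φ : Euc N → ℝ) : Prop where
  contDiff : ContDiff ℝ ∞ φ
  hasCompactSupport : HasCompactSupport φ
  tsupport_subset : tsupport φ ⊆ Ω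

/-- `f` is the Laplacian of `u` on `Ω` in the sense of distributions. -/
def IsDistribLaplacian {N : ℕ} (Ω : Set (Euc N)) (u f : Euc N → ℝ) : Prop :=
  ∀ φ : Euc N → ℝ, IsTestFunction Ω φ → ∫ x in Ω, u x * Δ φ x = ∫ x in Ω, f x * φ x

/-- `u` belongs to the Sobolev space `H¹(Ω)`, and `G` is its weak gradient. -/
structure IsH1 {N : ℕ} (Ω : Set (Euc N)) (u : Euc N → ℝ) (G : Euc N → Euc N) : Prop where
  memLp : MemLp u 2 (volume.restrict Ω)
  memLp_grad : MemLp G 2 (volume.restrict Ω)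
  integral_by_parts : ∀ φ : Euc N → ℝ, IsTestFunction Ω φ →
    ∫ x in Ω, u x • gradient φ x = - ∫ x in Ω, φ x • G x

/-- `τ` is the trace on `∂Ω` of the function `φ ∈ H¹(Ω)` with weak gradient `G`: some smooth
functions on `ℝ^N` converge to `φ` in `H¹(Ω)`, while their restrictions to `∂Ω` converge to `τ`
in `L²(∂Ω, σ)`. -/
def IsTrace {N : ℕ} (Ω : Set (Euc N)) (φ : Euc N → ℝ) (G : Euc N → Euc N) (τ : Euc N → ℝ) :
    Prop :=
  MemLp τ 2 (surfaceMeasure Ω) ∧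
    ∃ ψ : ℕ → Euc N → ℝ, (∀ n, ContDiff ℝ ∞ (ψ n)) ∧
      Tendsto (fun n => eLpNorm (fun x => ψ n x - φ x) 2 (volume.restrict Ω)) atTop (𝓝 0) ∧
      Tendsto (fun n => eLpNorm (fun x => gradient (ψ n) x - G x) 2 (volume.restrict Ω))
        atTop (𝓝 0) ∧
      Tendsto (fun n => eLpNorm (fun x => ψ n x - τ x) 2 (surfaceMeasure Ω)) atTop (𝓝 0)

/-- The domain `D(Δ_R)` of the Laplacian on `Ω` subject to Robin boundary conditions.
An element of `C(Ω̄)` is represented by a function that is continuous on `closure Ω`; its values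
elsewhere play no role. -/
def robinLaplacianDomain {N : ℕ} (Ω : Set (Euc N)) (β : Euc N → ℝ) : Set (Euc N → ℝ) :=
  {u | ContinuousOn u (closure Ω) ∧
    ∃ (G : Euc N → Euc N) (f : Euc N → ℝ),
      IsH1 Ω u G ∧ ContinuousOn f (closure Ω) ∧ IsDistribLaplacian Ω u f ∧
      ∀ (φ : Euc N → ℝ) (H : Euc N → Euc N) (τ : Euc N → ℝ), IsH1 Ω φ H → IsTrace Ω φ H τ →
        (∫ x in Ω, ⟪G x, H x⟫_ℝ) + (∫ x in Ω, f x * φ x)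
          + (∫ z, u z * τ z * β z ∂(surfaceMeasure Ω)) = 0}

/-- `D = D(Δ_R) ∩ C^∞(Ω̄)`. -/
def robinSmoothDomain {N : ℕ} (Ω : Set (Euc N)) (β : Euc N → ℝ) : Set (Euc N → ℝ) :=
  robinLaplacianDomain Ω β ∩ {u | ContDiffOn ℝ ∞ u (closure Ω)}

/-- The domain `D(Δ_0) = {v ∈ C₀(ℝ^N) | Δ v ∈ C₀(ℝ^N)}`, with `Δ` in the sense of distributions. -/
def laplacianZeroDomain (N : ℕ) : Set C₀(Euc N, ℝ) :=
  {v | ∃ f : C₀(Euc N, ℝ), IsDistribLaplacian Set.univ v f}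

/-- The map `T (p, t) = p + t ν(p)`. -/
def tubeMap {N : ℕ} (Ω : Set (Euc N)) (q : Euc N × ℝ) : Euc N :=
  q.1 + q.2 • outerNormal Ω q.1

/-- `δ > 0` is so small that `T` is a smooth diffeomorphism from `∂Ω × (-δ, δ)` onto an open
neighbourhood of `∂Ω` in `ℝ^N`. The manifold `∂Ω × (-δ, δ)` is embedded in `ℝ^N × ℝ`, so smoothness
of maps from and into it is smoothness on (into) this subset of `ℝ^N × ℝ`. -/
structure IsTubeWidth {N : ℕ} (Ω : Set (Euc N)) (δ : ℝ) : Prop where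
  pos : 0 < δ
  contDiffOn : ContDiffOn ℝ ∞ (tubeMap Ω) (frontier Ω ×ˢ Ioo (-δ) δ)
  injOn : InjOn (tubeMap Ω) (frontier Ω ×ˢ Ioo (-δ) δ)
  isOpen_image : IsOpen (tubeMap Ω '' (frontier Ω ×ˢ Ioo (-δ) δ))
  contDiffOn_inv : ContDiffOn ℝ ∞ (Function.invFunOn (tubeMap Ω) (frontier Ω ×ˢ Ioo (-δ) δ))
    (tubeMap Ω '' (frontier Ω ×ˢ Ioo (-δ) δ))

/-- The inverse `T⁻¹` of `T` on `∂Ω × (-δ, δ)`. -/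
def tubeInv {N : ℕ} (Ω : Set (Euc N)) (δ : ℝ) : Euc N → Euc N × ℝ :=
  Function.invFunOn (tubeMap Ω) (frontier Ω ×ˢ Ioo (-δ) δ)

/-- The properties of the auxiliary function `ρ₁ (γ, t)` on `[0, ∞) × [0, ∞)`. -/
structure IsKinkProfile (δ : ℝ) (ρ₁ : ℝ → ℝ → ℝ) : Prop where
  contDiffOn : ContDiffOn ℝ ∞ (fun q : ℝ × ℝ => ρ₁ q.1 q.2) (Ici 0 ×ˢ Ici 0)
  mem_Icc : ∀ γ t, 0 ≤ γ → 0 ≤ t → 0 ≤ ρ₁ γ t ∧ ρ₁ γ t ≤ 1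
  eq_zero : ∀ γ t, 0 ≤ γ → δ / 2 ≤ t → ρ₁ γ t = 0
  eq_one : ∀ γ, 0 ≤ γ → ρ₁ γ 0 = 1
  deriv_eq : ∀ γ, 0 ≤ γ → derivWithin (ρ₁ γ) (Ici 0) 0 = -2 * γ
  deriv_two_eq : ∀ γ, 0 ≤ γ → iteratedDerivWithin 2 (ρ₁ γ) (Ici 0) 0 = 4 * γ ^ 2

open Classical in
/-- The kinking function: `ρ(x) = ρ₁ (β(z), t)` if `x = T (z, t)` with `z ∈ ∂Ω`, `0 ≤ t < δ`, and
`ρ(x) = 0` otherwise. -/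
def kink {N : ℕ} (Ω : Set (Euc N)) (δ : ℝ) (ρ₁ : ℝ → ℝ → ℝ) (β : Euc N → ℝ) (x : Euc N) : ℝ :=
  if x ∈ tubeMap Ω '' (frontier Ω ×ˢ Ico 0 δ) then
    ρ₁ (β (tubeInv Ω δ x).1) (tubeInv Ω δ x).2
  else 0

/-- The orthogonal reflection `T (z, t) ↦ T (z, -t)` at the boundary. -/
def reflection {N : ℕ} (Ω : Set (Euc N)) (δ : ℝ) (x : Euc N) : Euc N :=
  tubeMap Ω ((tubeInv Ω δ x).1, -(tubeInv Ω δ x).2)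

open Classical in
/-- The extension `E_β u`, equal to `u` on `closure Ω` and to `ρ(x) u(x̃)` off `closure Ω`, where
`x̃` is the reflection of `x`. The product vanishes outside the tube since `ρ` does. -/
def robinExtension {N : ℕ} (Ω : Set (Euc N)) (δ : ℝ) (ρ₁ : ℝ → ℝ → ℝ) (β : Euc N → ℝ)
    (u : Euc N → ℝ) (x : Euc N) : ℝ :=
  if x ∈ closure Ω then u x else kink Ω δ ρ₁ β x * u (reflection Ω δ x)

end

/-! The extension `v` of `u` is compactly supported and of class C², so its classical Laplacian is
continuous with compact support, and integrating by parts twice identifies it with the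
distributional one (`mem_laplacianZeroDomain_of_contDiff`).

Regularity is in question only across ∂Ω. On the normal line through a boundary point p put k(t) =
v(p + tν). By construction k(t) = ρ₁(β(p), t) k(-t) for t ≥ 0. Hence k'(0+) = -2βk(0) - k'(0-),
which equals k'(0-) because the Robin condition reads k'(0-) = -βk(0); and k''(0+) = 4β²k(0) +
4βk'(0) + k''(0-), where the first two terms cancel for the same reason. Tangential derivatives are
determined by the values on ∂Ω and mixed ones follow from symmetry, so all derivatives up to order
two match (`contDiffOn_two_tube`, `contDiffOn_two_robinExtension_tube`).

The pointwise Robin condition has to be extracted from the weak one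
(`fderivWithin_outerNormal_of_mem`). Test with a bump of size r at p and divide by r^(N-1). As r → 0
the rescaled domain becomes a half space: the gradient term tends to c ∂u/∂ν(p), the term with Δu
tends to 0, and the boundary term tends to cβ(p)u(p), where c > 0 is the integral of the tangential
bump. Thus integration by parts is needed only for a product bump in a half space, and the Hausdorff
measure is compared with Lebesgue measure on the tangent space, ∂Ω being almost flat at small
scales. -/

open scoped NNReal

/-! ### Geometry of the tube: foot point, signed distance, sides of the boundary. -/

noncomputable section

/-- The open tube `T (∂Ω × (-δ, δ))` around the boundary. -/
def tube {N : ℕ} (Ω : Set (Euc N)) (δ : ℝ) : Set (Euc N) :=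
  tubeMap Ω '' (frontier Ω ×ˢ Ioo (-δ) δ)

/-- The foot point in `∂Ω` of a point of the tube. -/
def foot {N : ℕ} (Ω : Set (Euc N)) (δ : ℝ) (x : Euc N) : Euc N := (tubeInv Ω δ x).1

/-- The signed distance to `∂Ω` of a point of the tube. -/
def sdist {N : ℕ} (Ω : Set (Euc N)) (δ : ℝ) (x : Euc N) : ℝ := (tubeInv Ω δ x).2

lemma neg_mem_Ioo {δ t : ℝ} (ht : t ∈ Ioo (-δ) δ) : -t ∈ Ioo (-δ) δ :=
  ⟨neg_lt_neg ht.2, neg_lt.1 ht.1⟩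

namespace IsTubeWidth

variable {N : ℕ} {Ω : Set (Euc N)} {δ : ℝ} (hδ : IsTubeWidth Ω δ) {x p : Euc N} {t : ℝ}

include hδ

lemma isOpen_tube : IsOpen (tube Ω δ) := hδ.isOpen_image

omit hδ in
lemma tubeInv_mem (hx : x ∈ tube Ω δ) : tubeInv Ω δ x ∈ frontier Ω ×ˢ Ioo (-δ) δ :=
  Function.invFunOn_mem hx

omit hδ in
lemma foot_mem (hx : x ∈ tube Ω δ) : foot Ω δ x ∈ frontier Ω := (tubeInv_mem hx).1

omit hδ in
lemma sdist_mem (hx : x ∈ tube Ω δ) : sdist Ω δ x ∈ Ioo (-δ) δ := (tubeInv_mem hx).2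

omit hδ in
lemma foot_add (hx : x ∈ tube Ω δ) :
    foot Ω δ x + sdist Ω δ x • outerNormal Ω (foot Ω δ x) = x :=
  Function.invFunOn_eq hx

omit hδ in
lemma add_mem_tube (hp : p ∈ frontier Ω) (ht : t ∈ Ioo (-δ) δ) :
    p + t • outerNormal Ω p ∈ tube Ω δ := ⟨(p, t), ⟨hp, ht⟩, rfl⟩

lemma tubeInv_add (hp : p ∈ frontier Ω) (ht : t ∈ Ioo (-δ) δ) :
    tubeInv Ω δ (p + t • outerNormal Ω p) = (p, t) :=
  hδ.injOn.leftInvOn_invFunOn (x := (p, t)) ⟨hp, ht⟩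

lemma foot_add_smul (hp : p ∈ frontier Ω) (ht : t ∈ Ioo (-δ) δ) :
    foot Ω δ (p + t • outerNormal Ω p) = p := by
  rw [foot, hδ.tubeInv_add hp ht]

lemma sdist_add_smul (hp : p ∈ frontier Ω) (ht : t ∈ Ioo (-δ) δ) :
    sdist Ω δ (p + t • outerNormal Ω p) = t := by
  rw [sdist, hδ.tubeInv_add hp ht]

lemma zero_mem : (0 : ℝ) ∈ Ioo (-δ) δ := ⟨neg_lt_zero.2 hδ.pos, hδ.pos⟩

lemma mem_tube_of_mem_frontier (hp : p ∈ frontier Ω) : p ∈ tube Ω δ := by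
  simpa using add_mem_tube hp hδ.zero_mem

lemma foot_of_mem_frontier (hp : p ∈ frontier Ω) : foot Ω δ p = p := by
  simpa using hδ.foot_add_smul hp hδ.zero_mem

lemma sdist_of_mem_frontier (hp : p ∈ frontier Ω) : sdist Ω δ p = 0 := by
  simpa using hδ.sdist_add_smul hp hδ.zero_mem

/-- If there were no normal, the default value 0 would give T(p, δ/2) = p = T(p, 0), against
injectivity of T. -/
lemma isOuterUnitNormal (hp : p ∈ frontier Ω) : IsOuterUnitNormal Ω p (outerNormal Ω p) := by
  by_cases h : ∃ n, IsOuterUnitNormal Ω p n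
  · rw [outerNormal, dif_pos h]
    exact h.choose_spec
  · have h0 : outerNormal Ω p = 0 := by rw [outerNormal, dif_neg h]
    have h2 : δ / 2 ∈ Ioo (-δ) δ := ⟨by linarith [hδ.pos], by linarith [hδ.pos]⟩
    have := hδ.sdist_add_smul hp h2
    rw [h0, smul_zero, add_zero, hδ.sdist_of_mem_frontier hp] at this
    linarith [hδ.pos]

lemma norm_outerNormal (hp : p ∈ frontier Ω) : ‖outerNormal Ω p‖ = 1 :=
  (hδ.isOuterUnitNormal hp).norm_eq_one

lemma contDiffOn_foot : ContDiffOn ℝ ∞ (foot Ω δ) (tube Ω δ) :=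
  contDiff_fst.comp_contDiffOn hδ.contDiffOn_inv

lemma contDiffOn_sdist : ContDiffOn ℝ ∞ (sdist Ω δ) (tube Ω δ) :=
  contDiff_snd.comp_contDiffOn hδ.contDiffOn_inv

lemma contDiffOn_tubeMap_foot {s : Euc N → ℝ} (hs : ContDiffOn ℝ ∞ s (tube Ω δ))
    (hm : MapsTo s (tube Ω δ) (Ioo (-δ) δ)) :
    ContDiffOn ℝ ∞ (fun x => tubeMap Ω (foot Ω δ x, s x)) (tube Ω δ) :=
  hδ.contDiffOn.comp (hδ.contDiffOn_foot.prodMk hs) fun _ hx => ⟨foot_mem hx, hm hx⟩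

/-- The normal is recovered from T as the difference quotient (T(z, δ/2) - z) / (δ/2), so its
smoothness comes from that of T. -/
lemma contDiffOn_outerNormal_foot :
    ContDiffOn ℝ ∞ (fun x => outerNormal Ω (foot Ω δ x)) (tube Ω δ) := by
  have h2 : δ / 2 ∈ Ioo (-δ) δ := ⟨by linarith [hδ.pos], by linarith [hδ.pos]⟩
  have h := ((hδ.contDiffOn_tubeMap_foot (s := fun _ => δ / 2) contDiffOn_const
    fun _ _ => h2).sub hδ.contDiffOn_foot).const_smul (δ / 2)⁻¹
  refine h.congr fun x _ => ?_
  simp [tubeMap, smul_smul, hδ.pos.ne']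

lemma contDiffOn_reflection : ContDiffOn ℝ ∞ (reflection Ω δ) (tube Ω δ) :=
  hδ.contDiffOn_tubeMap_foot hδ.contDiffOn_sdist.neg fun _ hx =>
    neg_mem_Ioo (sdist_mem hx)

omit hδ in
lemma reflection_mem_tube (hx : x ∈ tube Ω δ) : reflection Ω δ x ∈ tube Ω δ :=
  add_mem_tube (foot_mem hx) (neg_mem_Ioo (sdist_mem hx))

lemma sdist_reflection (hx : x ∈ tube Ω δ) : sdist Ω δ (reflection Ω δ x) = -sdist Ω δ x :=
  hδ.sdist_add_smul (foot_mem hx) (neg_mem_Ioo (sdist_mem hx))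

lemma reflection_add_smul (hp : p ∈ frontier Ω) (ht : t ∈ Ioo (-δ) δ) :
    reflection Ω δ (p + t • outerNormal Ω p) = p - t • outerNormal Ω p := by
  rw [reflection, hδ.tubeInv_add hp ht, tubeMap]
  simp [sub_eq_add_neg]

lemma differentiableAt_foot (hx : x ∈ tube Ω δ) : DifferentiableAt ℝ (foot Ω δ) x :=
  (hδ.contDiffOn_foot.differentiableOn (by simp)).differentiableAt (hδ.isOpen_tube.mem_nhds hx)

lemma differentiableAt_sdist (hx : x ∈ tube Ω δ) : DifferentiableAt ℝ (sdist Ω δ) x :=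
  (hδ.contDiffOn_sdist.differentiableOn (by simp)).differentiableAt (hδ.isOpen_tube.mem_nhds hx)

/-- The foot point of a curve through p is a curve in ∂Ω, to which the normal is orthogonal. -/
lemma inner_outerNormal_fderiv_foot (hp : p ∈ frontier Ω) (w : Euc N) :
    ⟪outerNormal Ω p, fderiv ℝ (foot Ω δ) p w⟫_ℝ = 0 := by
  have hU := hδ.mem_tube_of_mem_frontier hp
  obtain ⟨r, hr, hball⟩ := Metric.isOpen_iff.1 hδ.isOpen_tube p hU
  obtain ⟨ε, hε, hεw⟩ : ∃ ε : ℝ, 0 < ε ∧ ε * ‖w‖ < r :=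
    ⟨r / (2 * (‖w‖ + 1)), by positivity, by
      rw [div_mul_eq_mul_div, div_lt_iff₀ (by positivity)]
      nlinarith [norm_nonneg w]⟩
  -- The curve must be smooth on all of ℝ, while `foot` is smooth only on the tube; the bounded
  -- parameter sin t keeps the curve inside.
  have hline (t : ℝ) : p + (Real.sin t * ε) • w ∈ tube Ω δ := by
    apply hball
    rw [mem_ball_iff_norm, add_sub_cancel_left, norm_smul, norm_mul, Real.norm_eq_abs,
      Real.norm_of_nonneg hε.le, mul_assoc]
    exact (mul_le_of_le_one_left (by positivity) (Real.abs_sin_le_one t)).trans_lt hεw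
  set c : ℝ → Euc N := fun t => p + (Real.sin t * ε) • w with hc
  have hcs : ContDiff ℝ ∞ c :=
    contDiff_const.add ((Real.contDiff_sin.mul contDiff_const).smul contDiff_const)
  have hc0 : c 0 = p := by simp [hc]
  have hcd : HasDerivAt c (ε • w) 0 := by
    simpa [hc] using (((Real.hasDerivAt_sin 0).mul_const ε).smul_const w).const_add p
  have hd : HasDerivAt (foot Ω δ ∘ c) (fderiv ℝ (foot Ω δ) p (ε • w)) 0 := by
    have := (hδ.differentiableAt_foot hU).hasFDerivAt
    exact HasFDerivAt.comp_hasDerivAt (0 : ℝ) (hc0.symm ▸ this) hcd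
  have := (hδ.isOuterUnitNormal hp).orthogonal (foot Ω δ ∘ c)
    (hδ.contDiffOn_foot.comp_contDiff hcs hline)
    (Eventually.of_forall fun t => foot_mem (hline t))
    (by rw [Function.comp_apply, hc0, hδ.foot_of_mem_frontier hp])
  rw [hd.deriv, map_smul, inner_smul_right] at this
  exact (mul_eq_zero.1 this).resolve_left hε.ne'

/-- Differentiate x = foot + sdist · ν(foot) at p; the derivative of ν drops out since its
coefficient `sdist` vanishes there. -/
lemma fderiv_foot_add (hp : p ∈ frontier Ω) (w : Euc N) :
    fderiv ℝ (foot Ω δ) p w + fderiv ℝ (sdist Ω δ) p w • outerNormal Ω p = w := by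
  have hU := hδ.mem_tube_of_mem_frontier hp
  have hν : DifferentiableAt ℝ (fun x => outerNormal Ω (foot Ω δ x)) p :=
    (hδ.contDiffOn_outerNormal_foot.differentiableOn (by simp)).differentiableAt
      (hδ.isOpen_tube.mem_nhds hU)
  have h := (hδ.differentiableAt_foot hU).hasFDerivAt.add
    ((hδ.differentiableAt_sdist hU).hasFDerivAt.smul hν.hasFDerivAt)
  have h' := h.congr_of_eventuallyEq (f₁ := id) (by
    filter_upwards [hδ.isOpen_tube.mem_nhds hU] with y hy
    exact (foot_add hy).symm)
  have := congrArg (fun L : Euc N →L[ℝ] Euc N => L w) (h'.unique (hasFDerivAt_id p))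
  simpa [hδ.sdist_of_mem_frontier hp, hδ.foot_of_mem_frontier hp] using this

lemma fderiv_sdist (hp : p ∈ frontier Ω) (w : Euc N) :
    fderiv ℝ (sdist Ω δ) p w = ⟪outerNormal Ω p, w⟫_ℝ := by
  have h := congrArg (fun y => ⟪outerNormal Ω p, y⟫_ℝ) (hδ.fderiv_foot_add hp w)
  simpa [inner_add_right, hδ.inner_outerNormal_fderiv_foot hp, inner_smul_right,
    real_inner_self_eq_norm_sq, hδ.norm_outerNormal hp] using h

lemma fderiv_foot (hp : p ∈ frontier Ω) (w : Euc N) :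
    fderiv ℝ (foot Ω δ) p w = w - ⟪outerNormal Ω p, w⟫_ℝ • outerNormal Ω p := by
  rw [← hδ.fderiv_sdist hp, eq_sub_iff_add_eq, hδ.fderiv_foot_add hp]

lemma add_smul_notMem_frontier (hp : p ∈ frontier Ω) (ht : t ∈ Ioo (-δ) δ) (h0 : t ≠ 0) :
    p + t • outerNormal Ω p ∉ frontier Ω := fun h =>
  h0 (by rw [← hδ.sdist_add_smul hp ht, hδ.sdist_of_mem_frontier h])

lemma image_line_subset (hΩ : IsOpen Ω) (hp : p ∈ frontier Ω) {I : Set ℝ} (hI : I ⊆ Ioo (-δ) δ)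
    (h0 : 0 ∉ I) :
    (fun t : ℝ => p + t • outerNormal Ω p) '' I ⊆ Ω ∪ (closure Ω)ᶜ := by
  rintro _ ⟨s, hs, rfl⟩
  have := hδ.add_smul_notMem_frontier hp (hI hs) (fun h => h0 (h ▸ hs))
  rw [hΩ.frontier_eq] at this
  by_cases h : p + s • outerNormal Ω p ∈ Ω
  · exact Or.inl h
  · exact Or.inr fun hc => this ⟨hc, h⟩

/-- The open normal segment is connected and misses ∂Ω by injectivity of T, so it lies on one side;
the outward condition at small parameters tells which. -/
lemma add_smul_mem_of_neg (hΩ : IsOpen Ω) (hp : p ∈ frontier Ω) (ht : t ∈ Ioo (-δ) 0) :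
    p + t • outerNormal Ω p ∈ Ω := by
  have hpre : IsPreconnected ((fun t : ℝ => p + t • outerNormal Ω p) '' Ioo (-δ) 0) :=
    isPreconnected_Ioo.image _ (by fun_prop)
  obtain ⟨s, hs, hsd⟩ := ((hδ.isOuterUnitNormal hp).outward.and (Ioo_mem_nhdsGT hδ.pos)).exists
  refine hpre.subset_left_of_subset_union hΩ isClosed_closure.isOpen_compl
    (disjoint_compl_right.mono_left subset_closure)
    (hδ.image_line_subset hΩ hp (Ioo_subset_Ioo_right hδ.pos.le) (by simp)) ?_ ⟨t, ht, rfl⟩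
  exact ⟨_, ⟨-s, ⟨neg_lt_neg hsd.2, neg_lt_zero.2 hsd.1⟩, rfl⟩, by
    simpa [sub_eq_add_neg] using hs.1⟩

lemma add_smul_notMem_closure_of_pos (hΩ : IsOpen Ω) (hp : p ∈ frontier Ω) (ht : t ∈ Ioo 0 δ) :
    p + t • outerNormal Ω p ∉ closure Ω := by
  have hpre : IsPreconnected ((fun t : ℝ => p + t • outerNormal Ω p) '' Ioo 0 δ) :=
    isPreconnected_Ioo.image _ (by fun_prop)
  obtain ⟨s, hs, hsd⟩ := ((hδ.isOuterUnitNormal hp).outward.and (Ioo_mem_nhdsGT hδ.pos)).exists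
  refine hpre.subset_right_of_subset_union hΩ isClosed_closure.isOpen_compl
    (disjoint_compl_right.mono_left subset_closure)
    (hδ.image_line_subset hΩ hp (Ioo_subset_Ioo_left (neg_nonpos.2 hδ.pos.le)) (by simp)) ?_
    ⟨t, ht, rfl⟩
  exact ⟨_, ⟨s, hsd, rfl⟩, hs.2⟩

lemma mem_of_sdist_neg (hΩ : IsOpen Ω) (hx : x ∈ tube Ω δ) (h : sdist Ω δ x < 0) : x ∈ Ω := by
  rw [← foot_add hx]
  exact hδ.add_smul_mem_of_neg hΩ (foot_mem hx) ⟨(sdist_mem hx).1, h⟩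

lemma notMem_closure_of_sdist_pos (hΩ : IsOpen Ω) (hx : x ∈ tube Ω δ) (h : 0 < sdist Ω δ x) :
    x ∉ closure Ω := by
  rw [← foot_add hx]
  exact hδ.add_smul_notMem_closure_of_pos hΩ (foot_mem hx) ⟨h, (sdist_mem hx).2⟩

omit hδ in
lemma mem_frontier_of_sdist_eq_zero (hx : x ∈ tube Ω δ) (h : sdist Ω δ x = 0) :
    x ∈ frontier Ω := by
  have := foot_add hx
  rw [h, zero_smul, add_zero] at this
  exact this ▸ foot_mem hx

lemma mem_closure_iff (hΩ : IsOpen Ω) (hx : x ∈ tube Ω δ) :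
    x ∈ closure Ω ↔ sdist Ω δ x ≤ 0 := by
  refine ⟨fun h => not_lt.1 fun h' => hδ.notMem_closure_of_sdist_pos hΩ hx h' h, fun h => ?_⟩
  rcases h.lt_or_eq with h | h
  · exact subset_closure (hδ.mem_of_sdist_neg hΩ hx h)
  · exact frontier_subset_closure (mem_frontier_of_sdist_eq_zero hx h)

lemma mem_iff (hΩ : IsOpen Ω) (hx : x ∈ tube Ω δ) : x ∈ Ω ↔ sdist Ω δ x < 0 := by
  refine ⟨fun h => ?_, hδ.mem_of_sdist_neg hΩ hx⟩
  refine ((hδ.mem_closure_iff hΩ hx).1 (subset_closure h)).lt_of_ne fun h0 => ?_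
  exact (hΩ.frontier_eq ▸ mem_frontier_of_sdist_eq_zero hx h0).2 h

lemma reflection_mem_closure_iff (hΩ : IsOpen Ω) (hx : x ∈ tube Ω δ) :
    reflection Ω δ x ∈ closure Ω ↔ x ∉ Ω := by
  rw [hδ.mem_closure_iff hΩ (reflection_mem_tube hx), hδ.sdist_reflection hx, hδ.mem_iff hΩ hx,
    not_lt, neg_nonpos]

lemma hasStrictFDerivAt_sdist (hp : p ∈ frontier Ω) :
    HasStrictFDerivAt (sdist Ω δ) (fderiv ℝ (sdist Ω δ) p) p :=
  (hδ.contDiffOn_sdist.contDiffAt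
    (hδ.isOpen_tube.mem_nhds (hδ.mem_tube_of_mem_frontier hp))).hasStrictFDerivAt (by simp)

lemma tendsto_sdist_line (hp : p ∈ frontier Ω) (w : Euc N) :
    Tendsto (fun t : ℝ => t⁻¹ * sdist Ω δ (p + t • w)) (𝓝[>] 0) (𝓝 ⟪outerNormal Ω p, w⟫_ℝ) := by
  have hU := hδ.mem_tube_of_mem_frontier hp
  have h : HasDerivAt (fun t : ℝ => sdist Ω δ (p + t • w)) (fderiv ℝ (sdist Ω δ) p w) 0 := by
    have hc : HasDerivAt (fun t : ℝ => p + t • w) w 0 := by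
      simpa using ((hasDerivAt_id (0 : ℝ)).smul_const w).const_add p
    have h0 : HasFDerivAt (sdist Ω δ) (fderiv ℝ (sdist Ω δ) p) (p + (0 : ℝ) • w) := by
      simpa using (hδ.differentiableAt_sdist hU).hasFDerivAt
    exact h0.comp_hasDerivAt (f := fun t : ℝ => p + t • w) (0 : ℝ) hc
  have := (hasDerivAt_iff_tendsto_slope_zero.1 h).mono_left (nhdsGT_le_nhdsNE 0)
  rw [hδ.fderiv_sdist hp] at this
  simpa [hδ.sdist_of_mem_frontier hp] using this

lemma eventually_line_mem_tube (hp : p ∈ frontier Ω) (w : Euc N) :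
    ∀ᶠ t in 𝓝[>] (0 : ℝ), p + t • w ∈ tube Ω δ := by
  have hc : ContinuousAt (fun t : ℝ => p + t • w) 0 := by fun_prop
  refine (hc.eventually_mem ?_).filter_mono nhdsWithin_le_nhds
  simpa using hδ.isOpen_tube.mem_nhds (hδ.mem_tube_of_mem_frontier hp)

/-- Directions pointing inwards stay in `Ω` for a short time. -/
lemma eventually_add_smul_mem (hΩ : IsOpen Ω) (hp : p ∈ frontier Ω) {w : Euc N}
    (hw : ⟪outerNormal Ω p, w⟫_ℝ < 0) : ∀ᶠ t in 𝓝[>] (0 : ℝ), p + t • w ∈ Ω := by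
  filter_upwards [(hδ.tendsto_sdist_line hp w).eventually_lt_const hw,
    hδ.eventually_line_mem_tube hp w, self_mem_nhdsWithin] with t h1 h2 h3
  refine hδ.mem_of_sdist_neg hΩ h2 (not_le.1 fun h => h1.not_ge ?_)
  exact mul_nonneg (inv_nonneg.2 (le_of_lt h3)) h

/-- Directions pointing outwards leave `closure Ω` for a short time. -/
lemma eventually_add_smul_notMem_closure (hΩ : IsOpen Ω) (hp : p ∈ frontier Ω) {w : Euc N}
    (hw : 0 < ⟪outerNormal Ω p, w⟫_ℝ) : ∀ᶠ t in 𝓝[>] (0 : ℝ), p + t • w ∉ closure Ω := by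
  filter_upwards [(hδ.tendsto_sdist_line hp w).eventually_const_lt hw,
    hδ.eventually_line_mem_tube hp w, self_mem_nhdsWithin] with t h1 h2 h3
  refine hδ.notMem_closure_of_sdist_pos hΩ h2 (not_le.1 fun h => h1.not_ge ?_)
  exact mul_nonpos_of_nonneg_of_nonpos (inv_nonneg.2 (le_of_lt h3)) h

omit hδ in
-- The tangent cone contains an open half space, which spans.
lemma _root_.uniqueDiffWithinAt_of_halfSpace {s : Set (Euc N)} {n : Euc N} (hn : n ≠ 0)
    (h : ∀ w, 0 < ⟪n, w⟫_ℝ → ∀ᶠ t in 𝓝[>] (0 : ℝ), p + t • w ∈ s) :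
    UniqueDiffWithinAt ℝ s p := by
  have hpos : 0 < ⟪n, n⟫_ℝ := real_inner_self_pos.2 hn
  have hcone : {w : Euc N | 0 < ⟪n, w⟫_ℝ} ⊆ tangentConeAt ℝ s p := fun w hw =>
    mem_tangentConeAt_of_add_smul_mem (tendsto_id'.2 (nhdsGT_le_nhdsNE 0)) (h w hw)
  refine ⟨?_, ?_⟩
  · have : Submodule.span ℝ (tangentConeAt ℝ s p) = ⊤ := by
      refine Submodule.eq_top_of_nonempty_interior' _ ⟨n, ?_⟩
      refine mem_interior.2 ⟨_, hcone.trans Submodule.subset_span, ?_, hpos⟩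
      exact isOpen_lt continuous_const (by fun_prop)
    rw [this]
    simp
  · have hc : Tendsto (fun t : ℝ => p + t • n) (𝓝[>] 0) (𝓝 p) := by
      have : ContinuousAt (fun t : ℝ => p + t • n) 0 := by fun_prop
      simpa using this.tendsto.mono_left nhdsWithin_le_nhds
    exact mem_closure_of_tendsto hc (h n hpos)

lemma outerNormal_ne_zero (hp : p ∈ frontier Ω) : outerNormal Ω p ≠ 0 := by
  intro h
  simpa [h] using hδ.norm_outerNormal hp

lemma uniqueDiffWithinAt (hΩ : IsOpen Ω) (hp : p ∈ frontier Ω) : UniqueDiffWithinAt ℝ Ω p :=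
  uniqueDiffWithinAt_of_halfSpace (neg_ne_zero.2 (hδ.outerNormal_ne_zero hp)) fun w hw =>
    hδ.eventually_add_smul_mem hΩ hp (by simpa using hw)

lemma uniqueDiffWithinAt_compl (hΩ : IsOpen Ω) (hp : p ∈ frontier Ω) :
    UniqueDiffWithinAt ℝ (closure Ω)ᶜ p :=
  uniqueDiffWithinAt_of_halfSpace (hδ.outerNormal_ne_zero hp) fun _ hw =>
    hδ.eventually_add_smul_notMem_closure hΩ hp hw

lemma uniqueDiffOn_closure (hΩ : IsOpen Ω) : UniqueDiffOn ℝ (closure Ω) := fun p hp => by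
  by_cases h : p ∈ Ω
  · exact (hΩ.uniqueDiffWithinAt h).mono subset_closure
  · exact (hδ.uniqueDiffWithinAt hΩ (hΩ.frontier_eq ▸ ⟨hp, h⟩)).mono subset_closure

lemma uniqueDiffOn_tube_inter_closure (hΩ : IsOpen Ω) :
    UniqueDiffOn ℝ (closure Ω ∩ tube Ω δ) :=
  (hδ.uniqueDiffOn_closure hΩ).inter hδ.isOpen_tube

lemma uniqueDiffOn_tube_diff (hΩ : IsOpen Ω) : UniqueDiffOn ℝ (tube Ω δ \ Ω) := by
  have : UniqueDiffOn ℝ Ωᶜ := fun p hp => by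
    by_cases h : p ∈ closure Ω
    · exact (hδ.uniqueDiffWithinAt_compl hΩ (hΩ.frontier_eq ▸ ⟨h, hp⟩)).mono
        (compl_subset_compl.2 subset_closure)
    · exact (isClosed_closure.isOpen_compl.uniqueDiffWithinAt h).mono
        (compl_subset_compl.2 subset_closure)
  rw [sdiff_eq, inter_comm]
  exact this.inter hδ.isOpen_tube

end IsTubeWidth

/-! ### Gluing C¹ functions along relatively closed pieces. -/

section Gluing

variable {E F : Type*} [NormedAddCommGroup E] [NormedSpace ℝ E] [NormedAddCommGroup F]
  [NormedSpace ℝ F] {f : E → F} {A B U : Set E}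

/-- The derivative of a function that is differentiable on two sets covering an open set, with
matching derivatives on the intersection. -/
lemma hasFDerivAt_of_fderivWithin_eq (hU : IsOpen U) (hAB : A ∪ B = U)
    (hA : closure A ∩ U ⊆ A) (hB : closure B ∩ U ⊆ B)
    (hfA : DifferentiableOn ℝ f A) (hfB : DifferentiableOn ℝ f B)
    (h : ∀ x ∈ A ∩ B, fderivWithin ℝ f A x = fderivWithin ℝ f B x) :
    (∀ x ∈ A, HasFDerivAt f (fderivWithin ℝ f A x) x) ∧
      ∀ x ∈ B, HasFDerivAt f (fderivWithin ℝ f B x) x := by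
  have key {x : E} (hx : x ∈ U) {L : E →L[ℝ] F} (h1 : HasFDerivWithinAt f L A x)
      (h2 : HasFDerivWithinAt f L B x) : HasFDerivAt f L x := by
    have := h1.union h2
    rw [hAB] at this
    exact this.hasFDerivAt (hU.mem_nhds hx)
  constructor
  · intro x hx
    have hxU : x ∈ U := hAB ▸ Or.inl hx
    refine key hxU (hfA x hx).hasFDerivWithinAt ?_
    by_cases hxB : x ∈ B
    · exact h x ⟨hx, hxB⟩ ▸ (hfB x hxB).hasFDerivWithinAt
    -- Off the closure of `B` a derivative within `B` is a vacuous condition; relative closedness of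
    -- `B` excludes limit points.
    · exact HasFDerivWithinAt.of_notMem_closure fun hc => hxB (hB ⟨hc, hxU⟩)
  · intro x hx
    have hxU : x ∈ U := hAB ▸ Or.inr hx
    refine key hxU ?_ (hfB x hx).hasFDerivWithinAt
    by_cases hxA : x ∈ A
    · exact h x ⟨hxA, hx⟩ ▸ (hfA x hxA).hasFDerivWithinAt
    · exact HasFDerivWithinAt.of_notMem_closure fun hc => hxA (hA ⟨hc, hxU⟩)

omit [NormedSpace ℝ E] in
lemma continuousOn_of_cover (hAB : A ∪ B = U)
    (hA : closure A ∩ U ⊆ A) (hB : closure B ∩ U ⊆ B) {X : Type*} [TopologicalSpace X] {g : E → X}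
    (hgA : ContinuousOn g A) (hgB : ContinuousOn g B) : ContinuousOn g U := by
  intro x hx
  rw [← hAB]
  refine ContinuousWithinAt.union ?_ ?_
  · by_cases hxA : x ∈ A
    · exact hgA x hxA
    · exact continuousWithinAt_of_notMem_closure fun hc => hxA (hA ⟨hc, hx⟩)
  · by_cases hxB : x ∈ B
    · exact hgB x hxB
    · exact continuousWithinAt_of_notMem_closure fun hc => hxB (hB ⟨hc, hx⟩)

/-- Two `C^1` pieces with matching derivatives glue to a `C^1` function. -/
lemma contDiffOn_one_of_fderivWithin_eq (hU : IsOpen U) (hAB : A ∪ B = U)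
    (hA : closure A ∩ U ⊆ A) (hB : closure B ∩ U ⊆ B) (huA : UniqueDiffOn ℝ A)
    (huB : UniqueDiffOn ℝ B) (hfA : ContDiffOn ℝ 1 f A) (hfB : ContDiffOn ℝ 1 f B)
    (h : ∀ x ∈ A ∩ B, fderivWithin ℝ f A x = fderivWithin ℝ f B x) :
    ContDiffOn ℝ 1 f U := by
  obtain ⟨h1, h2⟩ := hasFDerivAt_of_fderivWithin_eq hU hAB hA hB
    (hfA.differentiableOn (by simp)) (hfB.differentiableOn (by simp)) h
  have hfU : DifferentiableOn ℝ f U := by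
    rw [← hAB]
    rintro x (hx | hx)
    · exact (h1 x hx).differentiableAt.differentiableWithinAt
    · exact (h2 x hx).differentiableAt.differentiableWithinAt
  rw [show (1 : WithTop ℕ∞) = 0 + 1 by simp, contDiffOn_succ_iff_fderiv_of_isOpen hU]
  refine ⟨hfU, by simp, ?_⟩
  rw [contDiffOn_zero]
  refine continuousOn_of_cover hAB hA hB ?_ ?_
  · exact (hfA.continuousOn_fderivWithin huA le_rfl).congr fun x hx => (h1 x hx).fderiv
  · exact (hfB.continuousOn_fderivWithin huB le_rfl).congr fun x hx => (h2 x hx).fderiv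

end Gluing

/-! ### Gluing across the boundary: only normal derivatives need checking. -/

namespace IsTubeWidth

variable {N : ℕ} {Ω : Set (Euc N)} {δ : ℝ} (hδ : IsTubeWidth Ω δ)
  {F : Type*} [NormedAddCommGroup F] [NormedSpace ℝ F] {f : Euc N → F} {p : Euc N}

include hδ

omit hδ in
-- Both pieces include ∂Ω: this makes them relatively closed in the tube, with overlap exactly ∂Ω.
lemma tube_cover (hΩ : IsOpen Ω) :
    (closure Ω ∩ tube Ω δ) ∪ (tube Ω δ \ Ω) = tube Ω δ ∧
    closure (closure Ω ∩ tube Ω δ) ∩ tube Ω δ ⊆ closure Ω ∩ tube Ω δ ∧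
    closure (tube Ω δ \ Ω) ∩ tube Ω δ ⊆ tube Ω δ \ Ω := by
  refine ⟨?_, ?_, ?_⟩
  · ext x
    have := @subset_closure _ _ Ω x
    simp only [mem_union, mem_inter_iff, Set.mem_sdiff]
    tauto
  · rintro x ⟨h1, h2⟩
    exact ⟨closure_minimal inter_subset_left isClosed_closure h1, h2⟩
  · rintro x ⟨h1, h2⟩
    exact ⟨h2, closure_minimal (fun y hy => hy.2) hΩ.isClosed_compl h1⟩

lemma mem_both (hΩ : IsOpen Ω) (hp : p ∈ frontier Ω) :
    p ∈ (closure Ω ∩ tube Ω δ) ∩ (tube Ω δ \ Ω) := by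
  have h := hΩ.frontier_eq ▸ hp
  exact ⟨⟨h.1, hδ.mem_tube_of_mem_frontier hp⟩, hδ.mem_tube_of_mem_frontier hp, h.2⟩

omit hδ in
lemma mem_frontier_of_mem_both (hΩ : IsOpen Ω)
    (hp : p ∈ (closure Ω ∩ tube Ω δ) ∩ (tube Ω δ \ Ω)) : p ∈ frontier Ω :=
  hΩ.frontier_eq ▸ ⟨hp.1.1, hp.2.2⟩

/-- Tangential derivatives at the boundary are determined by the values on the boundary. -/
lemma fderivWithin_tangential {s : Set (Euc N)} (hs : frontier Ω ⊆ s) (hp : p ∈ frontier Ω)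
    (hf : DifferentiableWithinAt ℝ f s p) (w : Euc N) :
    fderivWithin ℝ f s p (w - ⟪outerNormal Ω p, w⟫_ℝ • outerNormal Ω p) =
      fderiv ℝ (f ∘ foot Ω δ) p w := by
  have hU := hδ.mem_tube_of_mem_frontier hp
  have h1 : HasFDerivWithinAt f (fderivWithin ℝ f s p) s (foot Ω δ p) := by
    rw [hδ.foot_of_mem_frontier hp]
    exact hf.hasFDerivWithinAt
  -- `foot` sends a full neighbourhood of p into ∂Ω ⊆ s, so the derivative within s suffices for the
  -- chain rule.
  have h2 := h1.comp_hasFDerivAt p (hδ.differentiableAt_foot hU).hasFDerivAt (by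
    filter_upwards [hδ.isOpen_tube.mem_nhds hU] with y hy using hs (foot_mem hy))
  rw [h2.fderiv, ContinuousLinearMap.comp_apply, hδ.fderiv_foot hp]

/-- Split w into its tangential part, where both derivatives equal that of `f ∘ foot`, and its
normal part, where `hν` applies. -/
lemma fderivWithin_eq (hΩ : IsOpen Ω) (hp : p ∈ frontier Ω)
    (hfA : DifferentiableOn ℝ f (closure Ω ∩ tube Ω δ))
    (hfB : DifferentiableOn ℝ f (tube Ω δ \ Ω))
    (hν : fderivWithin ℝ f (closure Ω ∩ tube Ω δ) p (outerNormal Ω p) =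
      fderivWithin ℝ f (tube Ω δ \ Ω) p (outerNormal Ω p)) :
    fderivWithin ℝ f (closure Ω ∩ tube Ω δ) p = fderivWithin ℝ f (tube Ω δ \ Ω) p := by
  have hm := hδ.mem_both hΩ hp
  ext w
  have h1 := hδ.fderivWithin_tangential (fun q hq => (hδ.mem_both hΩ hq).1) hp (hfA p hm.1) w
  have h2 := hδ.fderivWithin_tangential (fun q hq => (hδ.mem_both hΩ hq).2) hp (hfB p hm.2) w
  rw [map_sub, map_smul] at h1 h2
  rw [← sub_add_cancel (fderivWithin ℝ f (closure Ω ∩ tube Ω δ) p w)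
    (⟪outerNormal Ω p, w⟫_ℝ • fderivWithin ℝ f (closure Ω ∩ tube Ω δ) p (outerNormal Ω p)), h1,
    ← h2, hν, sub_add_cancel]

lemma contDiffOn_one_tube (hΩ : IsOpen Ω)
    (hfA : ContDiffOn ℝ 1 f (closure Ω ∩ tube Ω δ))
    (hfB : ContDiffOn ℝ 1 f (tube Ω δ \ Ω))
    (hν : ∀ p ∈ frontier Ω, fderivWithin ℝ f (closure Ω ∩ tube Ω δ) p (outerNormal Ω p) =
      fderivWithin ℝ f (tube Ω δ \ Ω) p (outerNormal Ω p)) :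
    ContDiffOn ℝ 1 f (tube Ω δ) := by
  obtain ⟨h1, h2, h3⟩ := tube_cover (δ := δ) hΩ
  refine contDiffOn_one_of_fderivWithin_eq hδ.isOpen_tube h1 h2 h3
    (hδ.uniqueDiffOn_tube_inter_closure hΩ) (hδ.uniqueDiffOn_tube_diff hΩ) hfA hfB fun p hp => ?_
  have hp' := mem_frontier_of_mem_both hΩ hp
  exact hδ.fderivWithin_eq hΩ hp' (hfA.differentiableOn (by simp))
    (hfB.differentiableOn (by simp)) (hν p hp')

/-- Two `C^2` pieces whose normal derivatives up to order two match glue to a `C^2` function. -/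
lemma contDiffOn_two_tube (hΩ : IsOpen Ω)
    (hfA : ContDiffOn ℝ 2 f (closure Ω ∩ tube Ω δ))
    (hfB : ContDiffOn ℝ 2 f (tube Ω δ \ Ω)) (hf : ContDiffOn ℝ 1 f (tube Ω δ))
    (hνν : ∀ p ∈ frontier Ω,
      fderivWithin ℝ (fderiv ℝ f) (closure Ω ∩ tube Ω δ) p (outerNormal Ω p) (outerNormal Ω p) =
      fderivWithin ℝ (fderiv ℝ f) (tube Ω δ \ Ω) p (outerNormal Ω p) (outerNormal Ω p)) :
    ContDiffOn ℝ 2 f (tube Ω δ) := by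
  have huA := hδ.uniqueDiffOn_tube_inter_closure hΩ
  have huB := hδ.uniqueDiffOn_tube_diff hΩ
  have hU := hδ.isOpen_tube
  have hd : ∀ x ∈ tube Ω δ, DifferentiableAt ℝ f x := fun x hx =>
    (hf.differentiableOn (by simp)).differentiableAt (hU.mem_nhds hx)
  have heA : EqOn (fderiv ℝ f) (fderivWithin ℝ f (closure Ω ∩ tube Ω δ))
      (closure Ω ∩ tube Ω δ) := fun x hx => ((hd x hx.2).fderivWithin (huA x hx)).symm
  have heB : EqOn (fderiv ℝ f) (fderivWithin ℝ f (tube Ω δ \ Ω)) (tube Ω δ \ Ω) :=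
    fun x hx => ((hd x hx.1).fderivWithin (huB x hx)).symm
  have hA1 : ContDiffOn ℝ 1 (fderiv ℝ f) (closure Ω ∩ tube Ω δ) :=
    (hfA.fderivWithin huA (by norm_num)).congr heA
  have hB1 : ContDiffOn ℝ 1 (fderiv ℝ f) (tube Ω δ \ Ω) :=
    (hfB.fderivWithin huB (by norm_num)).congr heB
  rw [show (2 : WithTop ℕ∞) = 1 + 1 by norm_num, contDiffOn_succ_iff_fderiv_of_isOpen hU]
  refine ⟨hf.differentiableOn (by simp), by simp, ?_⟩
  refine hδ.contDiffOn_one_tube hΩ hA1 hB1 fun p hp => ?_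
  have hm := hδ.mem_both hΩ hp
  -- Symmetry persists at the boundary point because it is a limit of interior points of the piece.
  have hsymA (v w : Euc N) : fderivWithin ℝ (fderiv ℝ f) (closure Ω ∩ tube Ω δ) p v w =
      fderivWithin ℝ (fderiv ℝ f) (closure Ω ∩ tube Ω δ) p w v := by
    have hs : IsSymmSndFDerivWithinAt ℝ f (closure Ω ∩ tube Ω δ) p :=
      (hfA p hm.1).isSymmSndFDerivWithinAt (by simp) huA (by
        have : p ∈ closure (Ω ∩ tube Ω δ) :=
          hU.closure_inter hm.1
        exact closure_mono (interior_maximal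
          (inter_subset_inter_left _ subset_closure) (hΩ.inter hU)) this) hm.1
    rw [fderivWithin_congr heA (heA hm.1)]
    exact hs v w
  have hsymB (v w : Euc N) : fderivWithin ℝ (fderiv ℝ f) (tube Ω δ \ Ω) p v w =
      fderivWithin ℝ (fderiv ℝ f) (tube Ω δ \ Ω) p w v := by
    have hs : IsSymmSndFDerivWithinAt ℝ f (tube Ω δ \ Ω) p :=
      (hfB p hm.2).isSymmSndFDerivWithinAt (by simp) huB (by
        have hsub : (closure Ω)ᶜ ∩ tube Ω δ ⊆ interior (tube Ω δ \ Ω) :=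
          interior_maximal (fun y hy => ⟨hy.2, fun h => hy.1 (subset_closure h)⟩)
            (isClosed_closure.isOpen_compl.inter hU)
        exact closure_mono hsub
          (hU.closure_inter ⟨(hδ.uniqueDiffWithinAt_compl hΩ hp).mem_closure, hm.2.1⟩)) hm.2
    rw [fderivWithin_congr heB (heB hm.2)]
    exact hs v w
  ext w
  have h1 := hδ.fderivWithin_tangential (fun q hq => (hδ.mem_both hΩ hq).1) hp
    (hA1.differentiableOn (by simp) p hm.1) w
  have h2 := hδ.fderivWithin_tangential (fun q hq => (hδ.mem_both hΩ hq).2) hp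
    (hB1.differentiableOn (by simp) p hm.2) w
  -- Differentiating `fderiv ℝ f` tangentially gives the same on both sides. With `hνν` this settles
  -- the pairs (w, ν), and symmetry exchanges them for (ν, w).
  have h12 := congrArg (fun L => L (outerNormal Ω p)) (h1.trans h2.symm)
  simp only [map_sub, map_smul, sub_apply, smul_apply, hνν p hp, sub_left_inj] at h12
  rw [hsymA, hsymB, h12]

end IsTubeWidth

/-! ### The extension is C² near the boundary. -/

namespace IsKinkProfile

variable {δ γ t : ℝ} {ρ₁ : ℝ → ℝ → ℝ} (hρ : IsKinkProfile δ ρ₁) (hγ : 0 ≤ γ)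

include hρ hγ

lemma contDiffOn_right : ContDiffOn ℝ ∞ (ρ₁ γ) (Ici 0) :=
  hρ.contDiffOn.comp (contDiff_const.prodMk contDiff_id).contDiffOn fun _ ht => ⟨hγ, ht⟩

lemma hasDerivWithinAt (ht : 0 ≤ t) :
    HasDerivWithinAt (ρ₁ γ) (derivWithin (ρ₁ γ) (Ici 0) t) (Ici 0) t :=
  ((hρ.contDiffOn_right hγ).differentiableOn (by simp) t ht).hasDerivWithinAt

lemma hasDerivWithinAt_two :
    HasDerivWithinAt (derivWithin (ρ₁ γ) (Ici 0)) (4 * γ ^ 2) (Ici 0) 0 := by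
  have h := ((hρ.contDiffOn_right hγ).derivWithin (m := 1) (uniqueDiffOn_Ici 0)
    (by norm_cast)).differentiableOn (by simp) 0 self_mem_Ici
  rw [← hρ.deriv_two_eq γ hγ, iteratedDerivWithin_succ, iteratedDerivWithin_one]
  exact h.hasDerivWithinAt

end IsKinkProfile

section Extension

variable {N : ℕ} {Ω : Set (Euc N)} {δ : ℝ} {ρ₁ : ℝ → ℝ → ℝ} {β u : Euc N → ℝ} {x p : Euc N}

lemma robinExtension_of_mem (hx : x ∈ closure Ω) : robinExtension Ω δ ρ₁ β u x = u x :=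
  if_pos hx

namespace IsTubeWidth

variable (hδ : IsTubeWidth Ω δ) (hΩ : IsOpen Ω) (hρ : IsKinkProfile δ ρ₁)
  (hβ : ∀ z ∈ frontier Ω, 0 ≤ β z)

include hδ hΩ hρ hβ

/-- The exterior formula persists on ∂Ω, where the extension is `u` by definition, because ρ₁(γ, 0)
= 1. Hence the exterior piece is smooth up to the boundary. -/
lemma robinExtension_of_notMem (hx : x ∈ tube Ω δ \ Ω) :
    robinExtension Ω δ ρ₁ β u x =
      ρ₁ (β (foot Ω δ x)) (sdist Ω δ x) * u (reflection Ω δ x) := by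
  have hs : 0 ≤ sdist Ω δ x := not_lt.1 fun h => hx.2 (hδ.mem_of_sdist_neg hΩ hx.1 h)
  by_cases hc : x ∈ closure Ω
  · have hf : x ∈ frontier Ω := hΩ.frontier_eq ▸ ⟨hc, hx.2⟩
    have hr := hδ.reflection_add_smul hf hδ.zero_mem
    rw [zero_smul, add_zero, sub_zero] at hr
    rw [robinExtension_of_mem hc, hr, hδ.sdist_of_mem_frontier hf, hδ.foot_of_mem_frontier hf,
      hρ.eq_one _ (hβ x hf), one_mul]
  · rw [robinExtension, if_neg hc, kink, if_pos]
    · rfl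
    · exact ⟨tubeInv Ω δ x, ⟨foot_mem hx.1, hs, (sdist_mem hx.1).2⟩, foot_add hx.1⟩

/-- The reflection law k(t) = ρ₁(β(p), t) k(-t), which reduces the matching of normal derivatives to
one-variable calculus. -/
lemma robinExtension_line (hp : p ∈ frontier Ω) {t : ℝ} (ht : t ∈ Ico 0 δ) :
    robinExtension Ω δ ρ₁ β u (p + t • outerNormal Ω p) =
      ρ₁ (β p) t * robinExtension Ω δ ρ₁ β u (p - t • outerNormal Ω p) := by
  have ht' : t ∈ Ioo (-δ) δ := ⟨(neg_lt_zero.2 hδ.pos).trans_le ht.1, ht.2⟩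
  have hm := add_mem_tube hp ht'
  have hn : p + t • outerNormal Ω p ∉ Ω := by
    rw [hδ.mem_iff hΩ hm, hδ.sdist_add_smul hp ht']
    exact not_lt.2 ht.1
  have hr : p - t • outerNormal Ω p ∈ closure Ω := by
    rw [← hδ.reflection_add_smul hp ht', hδ.reflection_mem_closure_iff hΩ hm]
    exact hn
  rw [hδ.robinExtension_of_notMem hΩ hρ hβ ⟨hm, hn⟩, robinExtension_of_mem hr,
    hδ.foot_add_smul hp ht', hδ.sdist_add_smul hp ht', hδ.reflection_add_smul hp ht']

omit hδ hΩ hρ hβ in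
lemma contDiffOn_robinExtension_inside (hu : ContDiffOn ℝ ∞ u (closure Ω)) :
    ContDiffOn ℝ ∞ (robinExtension Ω δ ρ₁ β u) (closure Ω) :=
  hu.congr fun _ hx => robinExtension_of_mem hx

lemma contDiffOn_robinExtension_outside (hβs : ContDiffOn ℝ ∞ β (frontier Ω))
    (hu : ContDiffOn ℝ ∞ u (closure Ω)) :
    ContDiffOn ℝ ∞ (robinExtension Ω δ ρ₁ β u) (tube Ω δ \ Ω) := by
  have hsub : tube Ω δ \ Ω ⊆ tube Ω δ := sdiff_subset
  have h1 : ContDiffOn ℝ ∞ (fun x => (β (foot Ω δ x), sdist Ω δ x)) (tube Ω δ \ Ω) :=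
    (hβs.comp (hδ.contDiffOn_foot.mono hsub) fun x hx => foot_mem (hsub hx)).prodMk
      (hδ.contDiffOn_sdist.mono hsub)
  have h2 := hρ.contDiffOn.comp h1 fun x hx => ⟨hβ _ (foot_mem hx.1),
    not_lt.1 fun h => hx.2 (hδ.mem_of_sdist_neg hΩ hx.1 h)⟩
  have h3 := hu.comp (hδ.contDiffOn_reflection.mono hsub) fun x hx =>
    (hδ.reflection_mem_closure_iff hΩ hx.1).2 hx.2
  exact (h2.mul h3).congr fun x hx => hδ.robinExtension_of_notMem hΩ hρ hβ hx

omit hδ hΩ hρ hβ in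
lemma hasDerivWithinAt_line {F : Type*} [NormedAddCommGroup F] [NormedSpace ℝ F] {f : Euc N → F}
    {s : Set (Euc N)} {I : Set ℝ} {t : ℝ} {L : Euc N →L[ℝ] F}
    (hf : HasFDerivWithinAt f L s (p + t • outerNormal Ω p))
    (hI : MapsTo (fun t : ℝ => p + t • outerNormal Ω p) I s) :
    HasDerivWithinAt (fun t : ℝ => f (p + t • outerNormal Ω p)) (L (outerNormal Ω p)) I t := by
  have hc : HasDerivWithinAt (fun t : ℝ => p + t • outerNormal Ω p) (outerNormal Ω p) I t := by
    simpa using (((hasDerivAt_id t).smul_const (outerNormal Ω p)).const_add p).hasDerivWithinAt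
  exact hf.comp_hasDerivWithinAt t hc hI

omit hδ hΩ hρ hβ in
lemma hasDerivWithinAt_line_zero {F : Type*} [NormedAddCommGroup F] [NormedSpace ℝ F]
    {f : Euc N → F} {s : Set (Euc N)} {I : Set ℝ} (hf : DifferentiableWithinAt ℝ f s p)
    (hI : MapsTo (fun t : ℝ => p + t • outerNormal Ω p) I s) :
    HasDerivWithinAt (fun t : ℝ => f (p + t • outerNormal Ω p))
      (fderivWithin ℝ f s p (outerNormal Ω p)) I 0 :=
  hasDerivWithinAt_line (t := 0) (by simpa using hf.hasFDerivWithinAt) hI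

omit hρ hβ in
lemma mapsTo_line_inside (hp : p ∈ frontier Ω) :
    MapsTo (fun t : ℝ => p + t • outerNormal Ω p) (Ioc (-δ) 0) (closure Ω ∩ tube Ω δ) :=
  fun t ht => by
    have ht' : t ∈ Ioo (-δ) δ := ⟨ht.1, ht.2.trans_lt hδ.pos⟩
    have hm := add_mem_tube hp ht'
    refine ⟨(hδ.mem_closure_iff hΩ hm).2 ?_, hm⟩
    rw [hδ.sdist_add_smul hp ht']
    exact ht.2

omit hρ hβ in
lemma mapsTo_line_outside (hp : p ∈ frontier Ω) :
    MapsTo (fun t : ℝ => p + t • outerNormal Ω p) (Ico 0 δ) (tube Ω δ \ Ω) :=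
  fun t ht => by
    have ht' : t ∈ Ioo (-δ) δ := ⟨(neg_lt_zero.2 hδ.pos).trans_le ht.1, ht.2⟩
    have hm := add_mem_tube hp ht'
    refine ⟨hm, ?_⟩
    rw [hδ.mem_iff hΩ hm, hδ.sdist_add_smul hp ht']
    exact not_lt.2 ht.1

omit hδ hΩ hρ hβ in
lemma _root_.HasDerivWithinAt.comp_neg_Ico {f : ℝ → ℝ} {f' δ : ℝ}
    (hf : HasDerivWithinAt f f' (Ioc (-δ) 0) 0) :
    HasDerivWithinAt (fun t => f (-t)) (-f') (Ico 0 δ) 0 := by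
  have h0 : HasDerivWithinAt f f' (Ioc (-δ) 0) (-0) := by simpa using hf
  have := h0.scomp (h := fun t : ℝ => -t) (0 : ℝ) (hasDerivAt_neg (0 : ℝ)).hasDerivWithinAt
    (s := Ico 0 δ) fun t ht => ⟨neg_lt_neg ht.2, neg_nonpos.2 ht.1⟩
  simpa [Function.comp_def] using this

omit hδ hΩ hρ hβ in
lemma _root_.HasDerivWithinAt.unique_Ico {f : ℝ → ℝ} {a b δ t : ℝ} (ht : t ∈ Ico 0 δ)
    (ha : HasDerivWithinAt f a (Ico 0 δ) t) (hb : HasDerivWithinAt f b (Ico 0 δ) t) : a = b :=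
  (uniqueDiffOn_Ico 0 δ t ht).eq_deriv _ ha hb

lemma contDiffOn_two_robinExtension_tube (hβs : ContDiffOn ℝ ∞ β (frontier Ω))
    (hu : ContDiffOn ℝ ∞ u (closure Ω))
    (hR : ∀ p ∈ frontier Ω, fderivWithin ℝ u (closure Ω) p (outerNormal Ω p) = -(β p * u p)) :
    ContDiffOn ℝ 2 (robinExtension Ω δ ρ₁ β u) (tube Ω δ) := by
  set v := robinExtension Ω δ ρ₁ β u with hv
  have h0δ : (0 : ℝ) ∈ Ico 0 δ := ⟨le_rfl, hδ.pos⟩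
  have hsub : Ico (0 : ℝ) δ ⊆ Ici 0 := fun t ht => ht.1
  have hU := hδ.isOpen_tube
  have hA : ContDiffOn ℝ ∞ v (closure Ω ∩ tube Ω δ) :=
    (contDiffOn_robinExtension_inside hu).mono inter_subset_left
  have hB : ContDiffOn ℝ ∞ v (tube Ω δ \ Ω) :=
    hδ.contDiffOn_robinExtension_outside hΩ hρ hβ hβs hu
  have hle (k : ℕ) : (k : WithTop ℕ∞) ≤ (∞ : WithTop ℕ∞) := by norm_cast; exact le_top
  have hνA : ∀ p ∈ frontier Ω,
      fderivWithin ℝ v (closure Ω ∩ tube Ω δ) p (outerNormal Ω p) = -(β p * v p) := fun p hp => by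
    have hm := hδ.mem_both hΩ hp
    rw [fderivWithin_inter (hU.mem_nhds hm.1.2), fderivWithin_congr
      (fun x hx => robinExtension_of_mem hx) (robinExtension_of_mem hm.1.1), hR p hp, hv,
      robinExtension_of_mem hm.1.1]
  have hline : ∀ p ∈ frontier Ω, EqOn (fun t : ℝ => v (p + t • outerNormal Ω p))
      (fun t : ℝ => ρ₁ (β p) t * v (p + (-t) • outerNormal Ω p)) (Ico 0 δ) := fun p hp t ht => by
    simpa [sub_eq_add_neg] using hδ.robinExtension_line (u := u) hΩ hρ hβ hp ht
  have h1 : ContDiffOn ℝ 1 v (tube Ω δ) := by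
    refine hδ.contDiffOn_one_tube hΩ (hA.of_le (hle 1)) (hB.of_le (hle 1)) fun p hp => ?_
    have hm := hδ.mem_both hΩ hp
    have hkA := hasDerivWithinAt_line_zero (hA.differentiableOn (by simp) p hm.1)
      (hδ.mapsTo_line_inside hΩ hp)
    have hkB := hasDerivWithinAt_line_zero (hB.differentiableOn (by simp) p hm.2)
      (hδ.mapsTo_line_outside hΩ hp)
    -- Product rule at 0: k'(0+) = -2βk(0) - k'(0-), to be compared with k'(0-) = -βk(0).
    have hk := (((hρ.hasDerivWithinAt (hβ p hp) le_rfl).mono hsub).mul hkA.comp_neg_Ico).congr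
      (hline p hp) (hline p hp h0δ)
    have := hkB.unique_Ico h0δ hk
    rw [this, hρ.deriv_eq _ (hβ p hp), hρ.eq_one _ (hβ p hp), hνA p hp]
    simp
    ring
  refine hδ.contDiffOn_two_tube hΩ (hA.of_le (hle 2)) (hB.of_le (hle 2)) h1 fun p hp => ?_
  have hm := hδ.mem_both hΩ hp
  have hd : ∀ x ∈ tube Ω δ, HasFDerivAt v (fderiv ℝ v x) x := fun x hx =>
    ((h1.differentiableOn (by simp)).differentiableAt (hU.mem_nhds hx)).hasFDerivAt
  have huA := hδ.uniqueDiffOn_tube_inter_closure hΩ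
  have huB := hδ.uniqueDiffOn_tube_diff hΩ
  have hA1 : DifferentiableOn ℝ (fderiv ℝ v) (closure Ω ∩ tube Ω δ) :=
    ((hA.fderivWithin (m := 1) huA (hle 2)).differentiableOn (by simp)).congr fun x hx =>
      ((hd x hx.2).differentiableAt.fderivWithin (huA x hx)).symm
  have hB1 : DifferentiableOn ℝ (fderiv ℝ v) (tube Ω δ \ Ω) :=
    ((hB.fderivWithin (m := 1) huB (hle 2)).differentiableOn (by simp)).congr fun x hx =>
      ((hd x hx.1).differentiableAt.fderivWithin (huB x hx)).symm
  set ν := outerNormal Ω p with hνdef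
  have hk (t : ℝ) (ht : t ∈ Ioo (-δ) δ) (I : Set ℝ) : HasDerivWithinAt (fun t : ℝ => v (p + t • ν))
      (fderiv ℝ v (p + t • ν) ν) I t :=
    (hasDerivWithinAt_line (s := univ) (hd _ (add_mem_tube hp ht)).hasFDerivWithinAt
      (mapsTo_univ _ I))
  have hkneg (t : ℝ) (ht : t ∈ Ioo (-δ) δ) (I : Set ℝ) :
      HasDerivWithinAt (fun t : ℝ => v (p + (-t) • ν)) (-fderiv ℝ v (p + (-t) • ν) ν) I t := by
    have := (hk (-t) (neg_mem_Ioo ht) univ).scomp (h := fun t : ℝ => -t) t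
      (hasDerivAt_neg t).hasDerivWithinAt (mapsTo_univ _ I)
    simpa [Function.comp_def] using this
  have hk1 : EqOn (fun t : ℝ => fderiv ℝ v (p + t • ν) ν)
      (fun t => derivWithin (ρ₁ (β p)) (Ici 0) t * v (p + (-t) • ν) +
        ρ₁ (β p) t * -fderiv ℝ v (p + (-t) • ν) ν) (Ico 0 δ) := fun t ht => by
    have ht' : t ∈ Ioo (-δ) δ := ⟨(neg_lt_zero.2 hδ.pos).trans_le ht.1, ht.2⟩
    exact (hk t ht' _).unique_Ico ht ((((hρ.hasDerivWithinAt (hβ p hp) ht.1).mono hsub).mul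
      (hkneg t ht' _)).congr (hline p hp) (hline p hp ht))
  have hkA := (hasDerivWithinAt_line_zero (hA1 p hm.1) (hδ.mapsTo_line_inside hΩ hp)).clm_apply
    (hasDerivWithinAt_const _ _ ν)
  have hkB := (hasDerivWithinAt_line_zero (hB1 p hm.2) (hδ.mapsTo_line_outside hΩ hp)).clm_apply
    (hasDerivWithinAt_const _ _ ν)
  simp only [map_zero, add_zero] at hkA hkB
  -- Second order: k''(0+) = 4β²k(0) + 4βk'(0) + k''(0-), and k'(0) = -βk(0) cancels the first two
  -- terms.
  have hk2 := (((hρ.hasDerivWithinAt_two (hβ p hp)).mono hsub).mul (hkneg 0 hδ.zero_mem _)).add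
    (((hρ.hasDerivWithinAt (hβ p hp) le_rfl).mono hsub).mul hkA.comp_neg_Ico.neg)
  have := hkB.unique_Ico h0δ (hk2.congr hk1 (hk1 h0δ))
  have hν0 : fderiv ℝ v p ν = -(β p * v p) := by
    rw [← hνA p hp, (hd p hm.1.2).differentiableAt.fderivWithin (huA p hm.1)]
  rw [this, hρ.deriv_eq _ (hβ p hp), hρ.eq_one _ (hβ p hp)]
  simp [hν0]
  ring

end IsTubeWidth

end Extension

/-! ### Classical and distributional Laplacians agree for compactly supported C² functions. -/

section Green

variable {N : ℕ} {f g : Euc N → ℝ}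

lemma contDiff_fderiv_apply {n m : WithTop ℕ∞} (hf : ContDiff ℝ n f) (hm : m + 1 ≤ n)
    (e : Euc N) : ContDiff ℝ m (fun x => fderiv ℝ f x e) :=
  (hf.fderiv_right hm).clm_apply contDiff_const

lemma integral_mul_fderiv_fderiv (hf : ContDiff ℝ 1 f) (hg : ContDiff ℝ 2 g)
    (hfc : HasCompactSupport f) (e : Euc N) :
    ∫ x, f x * fderiv ℝ (fun y => fderiv ℝ g y e) x e =
      -∫ x, fderiv ℝ f x e * fderiv ℝ g x e := by
  have hg1 : ContDiff ℝ 1 (fun y => fderiv ℝ g y e) :=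
    contDiff_fderiv_apply hg (by norm_num) e
  have hc1 : Continuous fun x => fderiv ℝ f x e :=
    (contDiff_fderiv_apply hf (m := 0) (by norm_num) e).continuous
  have hc2 : Continuous fun x => fderiv ℝ (fun y => fderiv ℝ g y e) x e :=
    (contDiff_fderiv_apply hg1 (m := 0) (by norm_num) e).continuous
  have hfe : HasCompactSupport fun x => fderiv ℝ f x e := hfc.fderiv_apply (𝕜 := ℝ) e
  refine integral_mul_fderiv_eq_neg_fderiv_mul_of_integrable ?_ ?_ ?_
    (fun x _ => hf.differentiable (by simp) x) (fun x _ => hg1.differentiable (by simp) x)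
  · exact (hc1.mul hg1.continuous).integrable_of_hasCompactSupport hfe.mul_right
  · exact (hf.continuous.mul hc2).integrable_of_hasCompactSupport hfc.mul_right
  · exact (hf.continuous.mul hg1.continuous).integrable_of_hasCompactSupport hfc.mul_right

lemma laplacian_eq_sum_fderiv (hg : ContDiff ℝ 2 g) (x : Euc N) :
    Δ g x = ∑ i, fderiv ℝ (fun y => fderiv ℝ g y (EuclideanSpace.basisFun (Fin N) ℝ i)) x
      (EuclideanSpace.basisFun (Fin N) ℝ i) := by
  rw [InnerProductSpace.laplacian_eq_iteratedFDeriv_orthonormalBasis g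
    (EuclideanSpace.basisFun (Fin N) ℝ)]
  refine Finset.sum_congr rfl fun i _ => ?_
  rw [iteratedFDeriv_two_apply, fderiv_clm_apply
    ((hg.fderiv_right (m := 1) (by norm_num)).differentiable (by simp) x)
    (differentiableAt_const _)]
  simp

lemma continuous_laplacian (hg : ContDiff ℝ 2 g) : Continuous (Δ g) := by
  rw [show Δ g = fun x => _ from funext (laplacian_eq_sum_fderiv hg)]
  refine continuous_finsetSum _ fun i _ => ?_
  exact (contDiff_fderiv_apply (contDiff_fderiv_apply hg (m := 1) (by norm_num) _) (m := 0)
    (by norm_num) _).continuous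

lemma hasCompactSupport_laplacian (hgc : HasCompactSupport g) : HasCompactSupport (Δ g) :=
  HasCompactSupport.intro hgc fun x hx => by
    have h := InnerProductSpace.laplacian_congr_nhds (notMem_tsupport_iff_eventuallyEq.1 hx)
    rw [h.eq_of_nhds]
    exact congrFun InnerProductSpace.laplacian_const x

/-- Only the undifferentiated factor `f` has compact support and only `g` needs two derivatives, so
the formula can be applied with the roles exchanged. -/
lemma integral_mul_laplacian_eq (hf : ContDiff ℝ 1 f) (hg : ContDiff ℝ 2 g)
    (hfc : HasCompactSupport f) :
    ∫ x, f x * Δ g x = -∑ i, ∫ x, fderiv ℝ f x (EuclideanSpace.basisFun (Fin N) ℝ i) *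
      fderiv ℝ g x (EuclideanSpace.basisFun (Fin N) ℝ i) := by
  simp_rw [laplacian_eq_sum_fderiv hg, Finset.mul_sum]
  rw [integral_finsetSum, ← Finset.sum_neg_distrib]
  · exact Finset.sum_congr rfl fun i _ => integral_mul_fderiv_fderiv hf hg hfc _
  · intro i _
    have hc2 := (contDiff_fderiv_apply (contDiff_fderiv_apply hg (m := 1) (by norm_num)
      (EuclideanSpace.basisFun (Fin N) ℝ i)) (m := 0) (by norm_num)
      (EuclideanSpace.basisFun (Fin N) ℝ i)).continuous
    exact (hf.continuous.mul hc2).integrable_of_hasCompactSupport hfc.mul_right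

/-- The classical Laplacian of a compactly supported `C^2` function is its distributional
Laplacian. -/
lemma isDistribLaplacian_laplacian (hg : ContDiff ℝ 2 g) (hgc : HasCompactSupport g) :
    IsDistribLaplacian univ g (Δ g) := by
  intro φ hφ
  have hφ2 : ContDiff ℝ 2 φ := hφ.contDiff.of_le (by norm_cast)
  rw [setIntegral_univ, setIntegral_univ,
    integral_mul_laplacian_eq (hg.of_le (by norm_num)) hφ2 hgc]
  simp_rw [mul_comm (Δ g _)]
  rw [integral_mul_laplacian_eq (hφ2.of_le (by norm_num)) hg hφ.hasCompactSupport]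
  simp_rw [mul_comm]

lemma mem_laplacianZeroDomain_of_contDiff (hg : ContDiff ℝ 2 g) (hgc : HasCompactSupport g) :
    ∃ v ∈ laplacianZeroDomain N, (v : Euc N → ℝ) = g :=
  ⟨⟨⟨g, hg.continuous⟩, hgc.is_zero_at_infty⟩,
    ⟨⟨⟨Δ g, continuous_laplacian hg⟩, (hasCompactSupport_laplacian hgc).is_zero_at_infty⟩,
      isDistribLaplacian_laplacian hg hgc⟩, rfl⟩

end Green

/-! ### Compact support and global C² regularity of the extension. -/

section Extension

variable {N : ℕ} {Ω : Set (Euc N)} {δ : ℝ} {ρ₁ : ℝ → ℝ → ℝ} {β u : Euc N → ℝ} {x p : Euc N}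

namespace IsTubeWidth

/-- Since ρ₁ vanishes from δ/2 on, the extension is zero off `closure Ω` and this compact part of
the tube, hence dies out before the tube's outer edge. -/
lemma isCompact_outerTube (hδ : IsTubeWidth Ω δ) (hb : Bornology.IsBounded Ω) :
    IsCompact (tubeMap Ω '' (frontier Ω ×ˢ Icc 0 (δ / 2))) := by
  have hc : IsCompact (frontier Ω) :=
    hb.isCompact_closure.of_isClosed_subset isClosed_frontier frontier_subset_closure
  refine (hc.prod isCompact_Icc).image_of_continuousOn (hδ.contDiffOn.continuousOn.mono ?_)
  refine prod_mono le_rfl fun t ht => ⟨?_, ?_⟩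
  · linarith [hδ.pos, ht.1]
  · linarith [hδ.pos, ht.2]

lemma robinExtension_eq_zero (hδ : IsTubeWidth Ω δ) (hρ : IsKinkProfile δ ρ₁)
    (hβ : ∀ z ∈ frontier Ω, 0 ≤ β z)
    (hx : x ∉ closure Ω ∪ tubeMap Ω '' (frontier Ω ×ˢ Icc 0 (δ / 2))) :
    robinExtension Ω δ ρ₁ β u x = 0 := by
  rw [mem_union, not_or] at hx
  rw [robinExtension, if_neg hx.1, kink]
  split_ifs with h
  · obtain ⟨⟨z, t⟩, ⟨hz, ht⟩, rfl⟩ := h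
    have ht2 : δ / 2 < t := not_le.1 fun h => hx.2 ⟨(z, t), ⟨hz, ht.1, h⟩, rfl⟩
    have := hδ.tubeInv_add hz ⟨(neg_lt_zero.2 hδ.pos).trans_le ht.1, ht.2⟩
    rw [show tubeMap Ω (z, t) = z + t • outerNormal Ω z from rfl, this,
      hρ.eq_zero _ _ (hβ z hz) ht2.le, zero_mul]
  · rw [zero_mul]

lemma hasCompactSupport_robinExtension (hδ : IsTubeWidth Ω δ) (hb : Bornology.IsBounded Ω)
    (hρ : IsKinkProfile δ ρ₁) (hβ : ∀ z ∈ frontier Ω, 0 ≤ β z) :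
    HasCompactSupport (robinExtension Ω δ ρ₁ β u) :=
  HasCompactSupport.intro (hb.isCompact_closure.union (hδ.isCompact_outerTube hb))
    fun _ hx => hδ.robinExtension_eq_zero hρ hβ hx

/-- The extension of a function satisfying the Robin condition pointwise is of class `C^2`. -/
lemma contDiff_two_robinExtension (hδ : IsTubeWidth Ω δ) (hΩ : IsOpen Ω)
    (hb : Bornology.IsBounded Ω) (hρ : IsKinkProfile δ ρ₁) (hβ : ∀ z ∈ frontier Ω, 0 ≤ β z)
    (hβs : ContDiffOn ℝ ∞ β (frontier Ω)) (hu : ContDiffOn ℝ ∞ u (closure Ω))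
    (hR : ∀ p ∈ frontier Ω, fderivWithin ℝ u (closure Ω) p (outerNormal Ω p) = -(β p * u p)) :
    ContDiff ℝ 2 (robinExtension Ω δ ρ₁ β u) := by
  have hK := (hb.isCompact_closure.union (hδ.isCompact_outerTube hb)).isClosed
  refine contDiff_iff_contDiffAt.2 fun x => ?_
  by_cases hx : x ∈ tube Ω δ
  · exact (hδ.contDiffOn_two_robinExtension_tube hΩ hρ hβ hβs hu hR).contDiffAt
      (hδ.isOpen_tube.mem_nhds hx)
  by_cases hxΩ : x ∈ Ω
  · exact (((contDiffOn_robinExtension_inside hu).mono subset_closure).contDiffAt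
      (hΩ.mem_nhds hxΩ)).of_le (by norm_cast)
  have hxK : x ∉ closure Ω ∪ tubeMap Ω '' (frontier Ω ×ˢ Icc 0 (δ / 2)) := by
    rintro (h | ⟨⟨z, t⟩, ⟨hz, ht⟩, rfl⟩)
    · exact hx (hδ.mem_tube_of_mem_frontier (hΩ.frontier_eq ▸ ⟨h, hxΩ⟩))
    · exact hx (add_mem_tube hz ⟨by linarith [hδ.pos, ht.1], by linarith [hδ.pos, ht.2]⟩)
  exact (contDiffAt_const (c := (0 : ℝ))).congr_of_eventuallyEq (by
    filter_upwards [hK.isOpen_compl.mem_nhds hxK] with y hy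
    exact hδ.robinExtension_eq_zero hρ hβ hy)

end IsTubeWidth

end Extension

/-! ### Hausdorff measure of almost flat sets versus Lebesgue measure of their projections. -/

section AdaptedCoordinates

variable {m : ℕ}

/-- Linear coordinates of `ℝ^(m+1)` splitting it orthogonally into `n^⊥` and the line along the
unit vector `n`. -/
structure IsAdapted (n : Euc (m + 1)) (Φ : Euc (m + 1) ≃L[ℝ] Euc m × ℝ) : Prop where
  snd_eq : ∀ x, (Φ x).2 = ⟪n, x⟫_ℝ
  norm_sq : ∀ x, ‖x‖ ^ 2 = ‖(Φ x).1‖ ^ 2 + (Φ x).2 ^ 2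
  measurePreserving : MeasurePreserving Φ volume volume

/-- The linear splitting `ℝ^(m+1) = ℝ^m × ℝ` with the first coordinate put last. -/
def eucSplit (m : ℕ) : Euc (m + 1) ≃L[ℝ] Euc m × ℝ :=
  LinearEquiv.toContinuousLinearEquiv
    { toFun := fun x => (WithLp.toLp 2 fun i => x i.succ, x 0)
      invFun := fun q => WithLp.toLp 2 (Fin.cons q.2 q.1)
      map_add' := fun _ _ => rfl
      map_smul' := fun _ _ => rfl
      left_inv := fun x => by
        ext i
        refine Fin.cases ?_ (fun j => ?_) i <;> simp
      right_inv := fun q => by ext <;> simp }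

lemma eucSplit_apply (x : Euc (m + 1)) :
    eucSplit m x = (WithLp.toLp 2 fun i => x i.succ, x 0) := rfl

lemma measurePreserving_eucSplit : MeasurePreserving (eucSplit m) volume volume := by
  have h1 := PiLp.volume_preserving_ofLp (Fin (m + 1))
  have h2 := volume_preserving_piFinSuccAbove (fun _ : Fin (m + 1) => ℝ) 0
  have h3 : MeasurePreserving (Prod.swap : ℝ × (Fin m → ℝ) → (Fin m → ℝ) × ℝ) volume volume :=
    Measure.measurePreserving_swap
  have h4 : MeasurePreserving (Prod.map (WithLp.toLp 2 : (Fin m → ℝ) → Euc m) (id : ℝ → ℝ))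
      volume volume :=
    (PiLp.volume_preserving_toLp (Fin m)).prod (MeasurePreserving.id volume)
  exact ((h4.comp h3).comp h2).comp h1

lemma exists_isAdapted {n : Euc (m + 1)} (hn : ‖n‖ = 1) :
    ∃ Φ : Euc (m + 1) ≃L[ℝ] Euc m × ℝ, IsAdapted n Φ := by
  obtain ⟨b, hb⟩ := Orthonormal.exists_orthonormalBasis_extension_of_card_eq (𝕜 := ℝ)
    (E := Euc (m + 1)) (ι := Fin (m + 1)) (by simp) (v := fun _ => n) (s := {0})
    ⟨fun _ => hn, fun i j hij => (hij (Subsingleton.elim i j)).elim⟩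
  have hb0 : b 0 = n := hb 0 rfl
  refine ⟨b.repr.toContinuousLinearEquiv.trans (eucSplit m), ⟨fun x => ?_, fun x => ?_, ?_⟩⟩
  · rw [← hb0, ← b.repr_apply_apply]
    rfl
  · rw [← b.repr.norm_map, EuclideanSpace.norm_sq_eq, Fin.sum_univ_succ]
    rw [ContinuousLinearEquiv.trans_apply, eucSplit_apply, EuclideanSpace.norm_sq_eq]
    simp [add_comm]
  · exact measurePreserving_eucSplit.comp b.measurePreserving_repr

namespace IsAdapted

variable {n : Euc (m + 1)} {Φ : Euc (m + 1) ≃L[ℝ] Euc m × ℝ} (hΦ : IsAdapted n Φ)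

include hΦ

lemma norm_fst_le (x : Euc (m + 1)) : ‖(Φ x).1‖ ≤ ‖x‖ :=
  (pow_le_pow_iff_left₀ (norm_nonneg _) (norm_nonneg _) two_ne_zero).1 (by
    rw [hΦ.norm_sq x]; linarith [sq_nonneg (Φ x).2])

lemma norm_le (x : Euc (m + 1)) : ‖x‖ ≤ ‖(Φ x).1‖ + |(Φ x).2| := by
  refine (pow_le_pow_iff_left₀ (norm_nonneg _) (by positivity) two_ne_zero).1 ?_
  rw [hΦ.norm_sq x, ← sq_abs (Φ x).2]
  nlinarith [mul_nonneg (norm_nonneg (Φ x).1) (abs_nonneg (Φ x).2)]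

end IsAdapted

/-- The normalized Hausdorff measure under Lipschitz maps. -/
lemma LipschitzOnWith.euclideanHausdorffMeasure_image_le {X Y : Type*} [EMetricSpace X]
    [EMetricSpace Y] [MeasurableSpace X] [BorelSpace X] [MeasurableSpace Y] [BorelSpace Y]
    {K : ℝ≥0} {f : X → Y} {s : Set X} (h : LipschitzOnWith K f s) (d : ℕ) :
    Measure.euclideanHausdorffMeasure d (f '' s) ≤
      (K : ℝ≥0∞) ^ d * Measure.euclideanHausdorffMeasure d s := by
  have := h.hausdorffMeasure_image_le (d := d) (by positivity)
  rw [Measure.euclideanHausdorffMeasure_def, Measure.euclideanHausdorffMeasure_def,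
    Measure.smul_apply, Measure.smul_apply, ENNReal.smul_def, ENNReal.smul_def, smul_eq_mul,
    smul_eq_mul, mul_left_comm]
  gcongr
  simpa using this

variable {n : Euc (m + 1)} {Φ : Euc (m + 1) ≃L[ℝ] Euc m × ℝ} {S : Set (Euc (m + 1))} {κ : ℝ≥0}

/-- A set which is flat in direction `n` has at most the Hausdorff measure of its projection, up to
a factor close to one. -/
lemma IsAdapted.euclideanHausdorffMeasure_le (hΦ : IsAdapted n Φ) (hκ : κ < 1)
    (hS : ∀ x ∈ S, ∀ y ∈ S, |(Φ (x - y)).2| ≤ κ * ‖x - y‖) (p : Euc (m + 1)) (E : Set (Euc m)) :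
    Measure.euclideanHausdorffMeasure m (S ∩ (fun x => (Φ (x - p)).1) ⁻¹' E) ≤
      (((1 - κ)⁻¹ : ℝ≥0) : ℝ≥0∞) ^ m * volume E := by
  set q : Euc (m + 1) → Euc m := fun x => (Φ (x - p)).1 with hq
  have hκ' : (0 : ℝ) < 1 - κ := sub_pos.2 (by exact_mod_cast hκ)
  have hqs (x y) : q x - q y = (Φ (x - y)).1 := by
    simp only [hq, ← Prod.fst_sub, ← map_sub, sub_sub_sub_cancel_right]
  -- From ‖x - y‖ ≤ ‖q x - q y‖ + κ‖x - y‖: the projection is injective on `S` with Lipschitz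
  -- inverse.
  have hdist : ∀ x ∈ S, ∀ y ∈ S, dist x y ≤ (1 - (κ : ℝ))⁻¹ * dist (q x) (q y) := by
    intro x hx y hy
    rw [dist_eq_norm, dist_eq_norm, hqs, inv_mul_eq_div, le_div_iff₀ hκ']
    linarith [hΦ.norm_le (x - y), hS x hx y hy]
  have hinj : InjOn q S := fun x hx y hy h => by
    have := hdist x hx y hy
    rw [h, dist_self, mul_zero] at this
    exact dist_le_zero.1 this
  have hlip : LipschitzOnWith (1 - κ)⁻¹ (Function.invFunOn q S) (q '' S ∩ E) := by
    refine LipschitzOnWith.of_dist_le_mul fun a ha b hb => ?_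
    obtain ⟨x, hx, rfl⟩ := ha.1
    obtain ⟨y, hy, rfl⟩ := hb.1
    rw [hinj.leftInvOn_invFunOn hx, hinj.leftInvOn_invFunOn hy, NNReal.coe_inv,
      NNReal.coe_sub hκ.le]
    exact hdist x hx y hy
  have himg : S ∩ q ⁻¹' E ⊆ Function.invFunOn q S '' (q '' S ∩ E) := fun x hx =>
    ⟨q x, ⟨mem_image_of_mem q hx.1, hx.2⟩, hinj.leftInvOn_invFunOn hx.1⟩
  refine (measure_mono himg).trans ((hlip.euclideanHausdorffMeasure_image_le m).trans ?_)
  rw [EuclideanSpace.euclideanHausdorffMeasure_eq_volume]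
  gcongr
  exact inter_subset_right

/-- The Hausdorff measure of a set is at least the volume of its projection. -/
lemma IsAdapted.volume_le (hΦ : IsAdapted n Φ) (p : Euc (m + 1)) {E : Set (Euc m)}
    (hE : E ⊆ (fun x => (Φ (x - p)).1) '' S) :
    volume E ≤ Measure.euclideanHausdorffMeasure m (S ∩ (fun x => (Φ (x - p)).1) ⁻¹' E) := by
  set q : Euc (m + 1) → Euc m := fun x => (Φ (x - p)).1 with hq
  have hlip : LipschitzOnWith 1 q (S ∩ q ⁻¹' E) := by
    refine LipschitzOnWith.of_dist_le_mul fun x _ y _ => ?_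
    have : q x - q y = (Φ (x - y)).1 := by
      simp only [hq, ← Prod.fst_sub, ← map_sub, sub_sub_sub_cancel_right]
    rw [dist_eq_norm, dist_eq_norm, this, NNReal.coe_one, one_mul]
    exact hΦ.norm_fst_le _
  have h := hlip.euclideanHausdorffMeasure_image_le m
  rw [EuclideanSpace.euclideanHausdorffMeasure_eq_volume, ENNReal.coe_one, one_pow, one_mul] at h
  refine (measure_mono fun y hy => ?_).trans h
  obtain ⟨x, hx, rfl⟩ := hE hy
  exact ⟨x, ⟨hx, hy⟩, rfl⟩

end AdaptedCoordinates

/-! ### Flatness of the boundary at small scales. -/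

namespace IsTubeWidth

variable {m : ℕ} {Ω : Set (Euc (m + 1))} {δ : ℝ} {p : Euc (m + 1)}
  {Φ : Euc (m + 1) ≃L[ℝ] Euc m × ℝ}

/-- Near a boundary point the boundary is flat and projects onto a neighbourhood in the tangent
space. -/
lemma exists_flat (hδ : IsTubeWidth Ω δ) (hp : p ∈ frontier Ω) (hΦ : IsAdapted (outerNormal Ω p) Φ)
    {κ : ℝ≥0} (hκ0 : 0 < κ) (hκ : κ ≤ 1 / 2) :
    ∃ r > (0 : ℝ),
      (∀ x ∈ frontier Ω ∩ Metric.ball p r, ∀ y ∈ frontier Ω ∩ Metric.ball p r,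
        |(Φ (x - y)).2| ≤ κ * ‖x - y‖) ∧
      Metric.ball 0 (r / 2) ⊆ (fun x => (Φ (x - p)).1) '' (frontier Ω ∩ Metric.ball p r) := by
  have hU := hδ.mem_tube_of_mem_frontier hp
  -- Strict differentiability: near p, differences of `sdist` are those of the linear form ⟨ν, ·⟩ up
  -- to κ‖x - y‖.
  obtain ⟨s, hs, happ⟩ := (hδ.hasStrictFDerivAt_sdist hp).approximates_deriv_on_nhds (c := κ)
    (Or.inr hκ0)
  obtain ⟨r, hr, hball⟩ := Metric.mem_nhds_iff.1 (inter_mem hs (hδ.isOpen_tube.mem_nhds hU))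
  have hest : ∀ x ∈ Metric.ball p r, ∀ y ∈ Metric.ball p r,
      |sdist Ω δ x - sdist Ω δ y - (Φ (x - y)).2| ≤ κ * ‖x - y‖ := by
    intro x hx y hy
    have := happ x (hball hx).1 y (hball hy).1
    rwa [hδ.fderiv_sdist hp, ← hΦ.snd_eq] at this
  refine ⟨r, hr, fun x hx y hy => ?_, fun y hy => ?_⟩
  · have := hest x hx.2 y hy.2
    rwa [hδ.sdist_of_mem_frontier hx.1, hδ.sdist_of_mem_frontier hy.1, sub_self, zero_sub,
      abs_neg] at this
  · have hyr : ‖y‖ < r / 2 := mem_ball_zero_iff.1 hy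
    set c : ℝ → Euc (m + 1) := fun t => p + Φ.symm (y, t) with hc
    have hcc : Continuous c := by fun_prop
    have hcn (t : ℝ) : ‖Φ.symm (y, t)‖ ≤ ‖y‖ + |t| := by
      simpa using hΦ.norm_le (Φ.symm (y, t))
    have hcb : ∀ t ∈ Icc (-(r / 2)) (r / 2), c t ∈ Metric.ball p r := fun t ht => by
      rw [mem_ball_iff_norm, add_sub_cancel_left]
      linarith [hcn t, abs_le.2 ht]
    have hcd : ∀ t ∈ Icc (-(r / 2)) (r / 2), |sdist Ω δ (c t) - t| ≤ κ * (‖y‖ + |t|) :=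
      fun t ht => by
        have := hest (c t) (hcb t ht) p (Metric.mem_ball_self hr)
        rw [hδ.sdist_of_mem_frontier hp, sub_zero, hc, add_sub_cancel_left,
          ContinuousLinearEquiv.apply_symm_apply] at this
        exact this.trans (by gcongr; exact hcn t)
    have hκ' : (κ : ℝ) ≤ 1 / 2 := by exact_mod_cast hκ
    have hcont : ContinuousOn (fun t => sdist Ω δ (c t)) (Icc (-(r / 2)) (r / 2)) :=
      hδ.contDiffOn_sdist.continuousOn.comp hcc.continuousOn fun t ht => (hball (hcb t ht)).2
    have hr2 : |r / 2| = r / 2 := abs_of_pos (by linarith)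
    have hb : (κ : ℝ) * (‖y‖ + r / 2) ≤ r / 2 := by nlinarith [norm_nonneg y]
    have hle : -(r / 2) ≤ r / 2 := by linarith
    have h1 := hcd (r / 2) ⟨hle, le_rfl⟩
    have h2 := hcd (-(r / 2)) ⟨le_rfl, hle⟩
    rw [abs_neg, hr2] at h2
    rw [hr2] at h1
    -- On the normal line over y, `sdist` differs from t by at most κ(‖y‖ + |t|) ≤ r/2, so it
    -- changes sign on [-r/2, r/2]; its zero is the boundary point over y.
    obtain ⟨t, ht, ht0⟩ := intermediate_value_Icc hle hcont
      (show (0 : ℝ) ∈ Icc _ _ from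
        ⟨by linarith [(abs_le.1 h2).2], by linarith [(abs_le.1 h1).1]⟩)
    refine ⟨c t, ⟨mem_frontier_of_sdist_eq_zero (hball (hcb t ht)).2 ht0, hcb t ht⟩, ?_⟩
    simp [hc]

/-- The boundary has finite surface measure. -/
lemma surfaceMeasure_lt_top (hδ : IsTubeWidth Ω δ) (hb : Bornology.IsBounded Ω) :
    Measure.euclideanHausdorffMeasure m (frontier Ω) < ⊤ := by
  have hcpt : IsCompact (frontier Ω) :=
    hb.isCompact_closure.of_isClosed_subset isClosed_frontier frontier_subset_closure
  refine hcpt.measure_lt_top_of_nhdsWithin fun p hp => ?_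
  obtain ⟨Φ, hΦ⟩ := exists_isAdapted (hδ.norm_outerNormal hp)
  obtain ⟨r, hr, hflat, -⟩ := hδ.exists_flat hp hΦ (κ := 1 / 2) (by norm_num) le_rfl
  refine ⟨frontier Ω ∩ Metric.ball p r,
    inter_mem_nhdsWithin _ (Metric.ball_mem_nhds p hr), ?_⟩
  have hlt : (1 / 2 : ℝ≥0) < 1 := by rw [← NNReal.coe_lt_coe]; norm_num
  refine lt_of_le_of_lt (le_trans (measure_mono fun x hx => ?_)
    (hΦ.euclideanHausdorffMeasure_le hlt hflat p (Metric.ball 0 r)))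
    (ENNReal.mul_lt_top (by simp) measure_ball_lt_top)
  refine ⟨hx, mem_ball_zero_iff.2 ?_⟩
  exact (hΦ.norm_fst_le _).trans_lt (mem_ball_iff_norm.1 hx.2)

end IsTubeWidth

/-! ### Rescaled cylindrical test functions. -/

section Bump

variable {m : ℕ}

/-- A bump function on the tangent space. -/
def tangentBump (m : ℕ) : ContDiffBump (0 : Euc m) := ⟨1 / 2, 1, by norm_num, by norm_num⟩

/-- A bump function in the normal direction. -/
def normalBump : ContDiffBump (0 : ℝ) := ⟨1, 2, by norm_num, by norm_num⟩

/-- The product of the two bump functions in adapted coordinates. -/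
def cylinderBump (Φ : Euc (m + 1) ≃L[ℝ] Euc m × ℝ) (y : Euc (m + 1)) : ℝ :=
  tangentBump m (Φ y).1 * normalBump (Φ y).2

/-- The bump function rescaled to size `r` around `p`. -/
def scaledBump (Φ : Euc (m + 1) ≃L[ℝ] Euc m × ℝ) (p : Euc (m + 1)) (r : ℝ) (x : Euc (m + 1)) : ℝ :=
  cylinderBump Φ (r⁻¹ • (x - p))

variable {Φ : Euc (m + 1) ≃L[ℝ] Euc m × ℝ} {p : Euc (m + 1)} {r : ℝ}

lemma contDiff_cylinderBump : ContDiff ℝ ∞ (cylinderBump Φ) :=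
  ((tangentBump m).contDiff.comp (contDiff_fst.comp Φ.contDiff)).mul
    (normalBump.contDiff.comp (contDiff_snd.comp Φ.contDiff))

lemma contDiff_scaledBump : ContDiff ℝ ∞ (scaledBump Φ p r) :=
  contDiff_cylinderBump.comp ((contDiff_id.sub contDiff_const).const_smul _)

lemma cylinderBump_nonneg (y : Euc (m + 1)) : 0 ≤ cylinderBump Φ y :=
  mul_nonneg (tangentBump m).nonneg normalBump.nonneg

lemma cylinderBump_eq_zero {n : Euc (m + 1)} (hΦ : IsAdapted n Φ) {y : Euc (m + 1)}
    (hy : 3 ≤ ‖y‖) : cylinderBump Φ y = 0 := by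
  by_contra h
  rw [cylinderBump, mul_eq_zero, not_or] at h
  have h1 : ‖(Φ y).1‖ < 1 := not_le.1 fun hle =>
    h.1 ((tangentBump m).zero_of_le_dist (by simpa [tangentBump] using hle))
  have h2 : |(Φ y).2| < 2 := not_le.1 fun hle =>
    h.2 (normalBump.zero_of_le_dist (by simpa [normalBump] using hle))
  linarith [hΦ.norm_le y]

lemma hasCompactSupport_cylinderBump {n : Euc (m + 1)} (hΦ : IsAdapted n Φ) :
    HasCompactSupport (cylinderBump Φ) :=
  HasCompactSupport.intro (isCompact_closedBall (0 : Euc (m + 1)) 3) fun y hy =>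
    cylinderBump_eq_zero hΦ (by
      rw [mem_closedBall_zero_iff, not_le] at hy
      exact hy.le)

lemma scaledBump_eq_zero {n : Euc (m + 1)} (hΦ : IsAdapted n Φ) (hr : 0 < r) {x : Euc (m + 1)}
    (hx : 3 * r ≤ ‖x - p‖) : scaledBump Φ p r x = 0 := by
  refine cylinderBump_eq_zero hΦ ?_
  rw [norm_smul, norm_inv, Real.norm_of_nonneg hr.le, inv_mul_eq_div, le_div_iff₀ hr]
  exact hx

lemma hasCompactSupport_scaledBump {n : Euc (m + 1)} (hΦ : IsAdapted n Φ) (hr : 0 < r) :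
    HasCompactSupport (scaledBump Φ p r) :=
  HasCompactSupport.intro (isCompact_closedBall p (3 * r)) fun x hx =>
    scaledBump_eq_zero hΦ hr (by
      rw [mem_closedBall_iff_norm, not_le] at hx
      exact hx.le)

/-- For κ ≤ 1/2 the normal component of x - p is at most the tangential one. So the normal factor
equals 1 wherever the tangential factor is nonzero, and on ∂Ω the bump depends on the tangential
coordinate alone. -/
lemma scaledBump_eq_tangentBump (hr : 0 < r) {x : Euc (m + 1)} {κ : ℝ≥0} {n : Euc (m + 1)}
    (hΦ : IsAdapted n Φ) (hκ : κ ≤ 1 / 2) (hx : |(Φ (x - p)).2| ≤ κ * ‖x - p‖) :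
    scaledBump Φ p r x = tangentBump m (r⁻¹ • (Φ (x - p)).1) := by
  have hκ' : (κ : ℝ) ≤ 1 / 2 := by exact_mod_cast hκ
  rw [scaledBump, cylinderBump, map_smul, Prod.smul_fst, Prod.smul_snd]
  by_cases h : r ≤ ‖(Φ (x - p)).1‖
  · rw [(tangentBump m).zero_of_le_dist, zero_mul]
    rw [dist_zero_right, norm_smul, norm_inv, Real.norm_of_nonneg hr.le, inv_mul_eq_div]
    exact (le_div_iff₀ hr).2 (by simpa [tangentBump] using h)
  · rw [normalBump.one_of_mem_closedBall, mul_one]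
    rw [mem_closedBall_zero_iff, norm_smul, norm_inv, Real.norm_of_nonneg hr.le, inv_mul_eq_div,
      div_le_iff₀ hr, Real.norm_eq_abs]
    have h1 := hΦ.norm_le (x - p)
    have h2 : (κ : ℝ) * ‖x - p‖ ≤ 1 / 2 * ‖x - p‖ := by gcongr
    simp only [normalBump]
    linarith

end Bump

/-! ### Limits of the boundary integrals. -/

namespace IsTubeWidth

variable {m : ℕ} {Ω : Set (Euc (m + 1))} {δ : ℝ} {p : Euc (m + 1)}
  {Φ : Euc (m + 1) ≃L[ℝ] Euc m × ℝ}

/-- Two-sided bound of the boundary integral of a rescaled bump function. -/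
lemma eventually_integral_scaledBump (hδ : IsTubeWidth Ω δ) (hp : p ∈ frontier Ω)
    (hΦ : IsAdapted (outerNormal Ω p) Φ) {κ : ℝ≥0} (hκ0 : 0 < κ) (hκ : κ ≤ 1 / 2) :
    ∀ᶠ r in 𝓝[>] (0 : ℝ),
      ∫ y, tangentBump m y ≤ (r ^ m)⁻¹ * ∫ x, scaledBump Φ p r x ∂(surfaceMeasure Ω) ∧
      (r ^ m)⁻¹ * ∫ x, scaledBump Φ p r x ∂(surfaceMeasure Ω) ≤
        ((1 - κ)⁻¹ : ℝ≥0) ^ m * ∫ y, tangentBump m y := by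
  obtain ⟨R, hR, hflat, hcov⟩ := hδ.exists_flat hp hΦ hκ0 hκ
  have hκ1 : κ < 1 := hκ.trans_lt (by rw [← NNReal.coe_lt_coe]; norm_num)
  set S := frontier Ω ∩ Metric.ball p R with hS
  set q : Euc (m + 1) → Euc m := fun x => (Φ (x - p)).1 with hq
  have hqm : Measurable q := by
    have : Continuous q := by fun_prop
    exact this.measurable
  have hSm : MeasurableSet S := isClosed_frontier.measurableSet.inter measurableSet_ball
  -- Surface measure pushed to the tangent space; it lies between Lebesgue measure on a ball and `K`
  -- times Lebesgue measure.
  set μ : Measure (Euc m) :=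
    (((Measure.euclideanHausdorffMeasure m : Measure (Euc (m + 1))).restrict S)).map q with hμ
  have hμE {E : Set (Euc m)} (hE : MeasurableSet E) :
      μ E = Measure.euclideanHausdorffMeasure m (S ∩ q ⁻¹' E) := by
    rw [hμ, Measure.map_apply hqm hE, Measure.restrict_apply (hqm hE), inter_comm]
  set K : ℝ≥0 := (1 - κ)⁻¹ ^ m with hK
  have hμle : μ ≤ (K : ℝ≥0∞) • volume := Measure.le_iff.2 fun E hE => by
    rw [hμE hE, Measure.smul_apply, smul_eq_mul, hK, ENNReal.coe_pow]
    exact hΦ.euclideanHausdorffMeasure_le hκ1 hflat p E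
  have hleμ : volume.restrict (Metric.ball 0 (R / 2)) ≤ μ := Measure.le_iff.2 fun E hE => by
    rw [Measure.restrict_apply hE, hμE hE]
    refine (hΦ.volume_le p (inter_subset_right.trans hcov)).trans (measure_mono ?_)
    exact inter_subset_inter_right _ (preimage_mono inter_subset_left)
  -- The bump vanishes beyond distance 3r < R from p, so only the flat patch `S` contributes.
  have hev : Ioo 0 (R / 6) ∈ 𝓝[>] (0 : ℝ) := Ioo_mem_nhdsGT (by positivity)
  filter_upwards [hev] with r hr
  have hrm : 0 < r ^ m := pow_pos hr.1 m
  set ψ : Euc m → ℝ := fun y => tangentBump m (r⁻¹ • y) with hψ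
  have hψc : Continuous ψ := (tangentBump m).continuous.comp (continuous_const_smul _)
  have hψ0 : ∀ y, 0 ≤ ψ y := fun y => (tangentBump m).nonneg
  have hψz : ∀ y, r ≤ ‖y‖ → ψ y = 0 := fun y hy => by
    refine (tangentBump m).zero_of_le_dist ?_
    rw [dist_zero_right, norm_smul, norm_inv, Real.norm_of_nonneg hr.1.le, inv_mul_eq_div]
    exact (le_div_iff₀ hr.1).2 (by simpa [tangentBump] using hy)
  have hψs : HasCompactSupport ψ :=
    HasCompactSupport.intro (isCompact_closedBall (0 : Euc m) r) fun y hy => hψz y (by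
      rw [mem_closedBall_zero_iff, not_le] at hy
      exact hy.le)
  have hψi : Integrable ψ := hψc.integrable_of_hasCompactSupport hψs
  have hψI : ∫ y, ψ y = r ^ m * ∫ y, tangentBump m y := by
    rw [hψ, Measure.integral_comp_inv_smul volume (fun y => tangentBump m y) r,
      finrank_euclideanSpace_fin, abs_of_pos hrm, smul_eq_mul]
  have hint : ∫ x, scaledBump Φ p r x ∂(surfaceMeasure Ω) = ∫ y, ψ y ∂μ := by
    rw [hμ, integral_map hqm.aemeasurable hψc.aestronglyMeasurable, surfaceMeasure,
      Nat.add_sub_cancel]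
    have hsub : S ⊆ frontier Ω := inter_subset_left
    refine (setIntegral_eq_of_subset_of_forall_sdiff_eq_zero isClosed_frontier.measurableSet hsub
      fun x hx => ?_).trans (setIntegral_congr_fun hSm fun x hx => ?_)
    · refine scaledBump_eq_zero hΦ hr.1 (not_lt.1 fun h => hx.2 ⟨hx.1, ?_⟩)
      rw [mem_ball_iff_norm]
      linarith [hr.2, hr.1]
    · exact scaledBump_eq_tangentBump hr.1 hΦ hκ (hflat x hx p ⟨hp, Metric.mem_ball_self hR⟩)
  have hKi : Integrable ψ ((K : ℝ≥0∞) • volume) := hψi.smul_measure ENNReal.coe_ne_top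
  rw [hint]
  constructor
  · have h1 : ∫ y in Metric.ball 0 (R / 2), ψ y ≤ ∫ y, ψ y ∂μ :=
      integral_mono_measure hleμ (Eventually.of_forall hψ0) (hKi.mono_measure hμle)
    rw [setIntegral_eq_integral_of_forall_compl_eq_zero (fun y hy => hψz y (by
      rw [mem_ball_zero_iff, not_lt] at hy
      linarith [hr.2, hr.1])), hψI] at h1
    rw [inv_mul_eq_div, le_div_iff₀ hrm]
    linarith
  · have h1 : ∫ y, ψ y ∂μ ≤ ∫ y, ψ y ∂((K : ℝ≥0∞) • volume) :=
      integral_mono_measure hμle (Eventually.of_forall hψ0) hKi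
    rw [integral_smul_measure, hψI, ENNReal.coe_toReal, smul_eq_mul] at h1
    rw [inv_mul_eq_div, div_le_iff₀ hrm]
    refine h1.trans (le_of_eq ?_)
    rw [hK, NNReal.coe_pow]
    ring

lemma integral_tangentBump_pos : 0 < ∫ y, tangentBump m y := (tangentBump m).integral_pos

/-- The lower bound is free of κ, and the factor (1 - κ)⁻¹ ^ m in the upper bound tends to 1 as κ →
0. -/
lemma tendsto_integral_scaledBump (hδ : IsTubeWidth Ω δ) (hp : p ∈ frontier Ω)
    (hΦ : IsAdapted (outerNormal Ω p) Φ) :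
    Tendsto (fun r => (r ^ m)⁻¹ * ∫ x, scaledBump Φ p r x ∂(surfaceMeasure Ω)) (𝓝[>] (0 : ℝ))
      (𝓝 (∫ y, tangentBump m y)) := by
  set c := ∫ y, tangentBump m y with hc
  have hcont : Tendsto (fun κ : ℝ≥0 => (((1 - κ)⁻¹ : ℝ≥0) : ℝ) ^ m * c) (𝓝[>] 0) (𝓝 c) := by
    have h1 : ContinuousAt (fun κ : ℝ≥0 => (1 - κ)⁻¹) 0 :=
      (continuousAt_const.sub continuousAt_id).inv₀ (by simp)
    have h2 : ContinuousAt (fun κ : ℝ≥0 => (((1 - κ)⁻¹ : ℝ≥0) : ℝ) ^ m * c) 0 :=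
      ((NNReal.continuous_coe.continuousAt.comp h1).pow m).mul continuousAt_const
    have := h2.tendsto.mono_left (nhdsWithin_le_nhds (s := Ioi 0))
    simpa using this
  refine tendsto_order.2 ⟨fun a ha => ?_, fun a ha => ?_⟩
  · filter_upwards [hδ.eventually_integral_scaledBump hp hΦ (κ := 1 / 2) (by norm_num) le_rfl]
      with r hr using ha.trans_le hr.1
  · have h12 : Ioc (0 : ℝ≥0) (1 / 2) ∈ 𝓝[>] (0 : ℝ≥0) := Ioc_mem_nhdsGT (by norm_num)
    obtain ⟨κ, hκ, hκm⟩ := ((hcont.eventually_lt_const ha).and h12).exists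
    filter_upwards [hδ.eventually_integral_scaledBump hp hΦ hκm.1 hκm.2]
      with r hr using hr.2.trans_lt hκ

/-- Rescaled boundary integrals concentrate at the boundary point. -/
lemma tendsto_integral_mul_scaledBump (hδ : IsTubeWidth Ω δ) (hb : Bornology.IsBounded Ω)
    (hp : p ∈ frontier Ω) (hΦ : IsAdapted (outerNormal Ω p) Φ) {h : Euc (m + 1) → ℝ}
    (hh : ContinuousOn h (frontier Ω)) :
    Tendsto (fun r => (r ^ m)⁻¹ * ∫ x, scaledBump Φ p r x * h x ∂(surfaceMeasure Ω))
      (𝓝[>] (0 : ℝ)) (𝓝 ((∫ y, tangentBump m y) * h p)) := by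
  set c := ∫ y, tangentBump m y with hc
  have hc0 : 0 < c := integral_tangentBump_pos
  have hcpt : IsCompact (frontier Ω) :=
    hb.isCompact_closure.of_isClosed_subset isClosed_frontier frontier_subset_closure
  have hfin := (hδ.surfaceMeasure_lt_top hb).ne
  -- Divided by c r^m, the bumps form an approximate identity at p for the surface measure.
  have hpeak := tendsto_setIntegral_peak_smul_of_integrableOn_of_tendsto
    (μ := (Measure.euclideanHausdorffMeasure m : Measure (Euc (m + 1)))) (l := 𝓝[>] (0 : ℝ))
    (x₀ := p) (φ := fun r x => c⁻¹ * (r ^ m)⁻¹ * scaledBump Φ p r x) (g := h) (a := h p)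
    isClosed_frontier.measurableSet isClosed_frontier.measurableSet le_rfl self_mem_nhdsWithin
    hfin ?_ ?_ ?_ ?_ ?_ (hh p hp)
  · have := hpeak.const_mul c
    refine this.congr fun r => ?_
    rw [surfaceMeasure, Nat.add_sub_cancel, ← integral_const_mul, ← integral_const_mul]
    congr 1
    ext x
    rw [smul_eq_mul]
    field_simp
  · filter_upwards [self_mem_nhdsWithin] with r hr x _
    have : 0 < r := hr
    have := cylinderBump_nonneg (Φ := Φ) (r⁻¹ • (x - p))
    rw [scaledBump]
    positivity
  · intro u hu hpu
    obtain ⟨R, hR, hball⟩ := Metric.isOpen_iff.1 hu p hpu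
    refine Metric.tendstoUniformlyOn_iff.2 fun ε hε => ?_
    filter_upwards [Ioo_mem_nhdsGT (show 0 < R / 3 by positivity)] with r hr x hx
    have hxR : R ≤ ‖x - p‖ := not_lt.1 fun h => hx.2 (hball (mem_ball_iff_norm.2 h))
    rw [scaledBump_eq_zero hΦ hr.1 (by linarith [hr.2])]
    simpa using hε
  · have := (hδ.tendsto_integral_scaledBump hp hΦ).const_mul c⁻¹
    rw [inv_mul_cancel₀ hc0.ne'] at this
    refine this.congr fun r => ?_
    rw [surfaceMeasure, Nat.add_sub_cancel, ← mul_assoc, ← integral_const_mul]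
  · exact Eventually.of_forall fun r => (continuous_const.mul
      contDiff_scaledBump.continuous).aestronglyMeasurable
  · exact hh.integrableOn_of_subset_isCompact hcpt isClosed_frontier.measurableSet le_rfl hfin

end IsTubeWidth

/-! ### The model integral in a half space. -/

section HalfSpace

variable {m : ℕ} {Φ : Euc (m + 1) ≃L[ℝ] Euc m × ℝ} {n p : Euc (m + 1)}

lemma integral_comp_add_smul (F : Euc (m + 1) → ℝ) {r : ℝ} (hr : 0 < r) (p : Euc (m + 1)) :
    ∫ y, F (p + r • y) = (r ^ (m + 1))⁻¹ * ∫ x, F x := by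
  rw [Measure.integral_comp_smul volume (fun y => F (p + y)) r, finrank_euclideanSpace_fin,
    integral_add_left_eq_self F p, abs_of_pos (by positivity), smul_eq_mul]

lemma integral_fderiv_eq_zero {N : ℕ} {f : Euc N → ℝ} (hf : ContDiff ℝ 1 f)
    (hs : HasCompactSupport f) (a : Euc N) : ∫ y, fderiv ℝ f y a = 0 := by
  have hd : Continuous fun y => fderiv ℝ f y a :=
    (contDiff_fderiv_apply hf (m := 0) (by norm_num) a).continuous
  have := integral_mul_fderiv_eq_neg_fderiv_mul_of_integrable (μ := volume) (v := a)
    (f := fun _ : Euc N => (1 : ℝ)) (g := f) (by simp)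
    (by simpa using hd.integrable_of_hasCompactSupport (hs.fderiv_apply (𝕜 := ℝ) a))
    (by simpa using hf.continuous.integrable_of_hasCompactSupport hs)
    (fun _ _ => differentiableAt_const _) (fun x _ => hf.differentiable (by simp) x)
  simpa using this

lemma fderiv_cylinderBump (y a : Euc (m + 1)) :
    fderiv ℝ (cylinderBump Φ) y a =
      fderiv ℝ (tangentBump m) (Φ y).1 (Φ a).1 * normalBump (Φ y).2 +
        tangentBump m (Φ y).1 * (deriv normalBump (Φ y).2 * (Φ a).2) := by
  have h1 : HasFDerivAt (fun y => (Φ y).1)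
      ((ContinuousLinearMap.fst ℝ (Euc m) ℝ).comp (Φ : Euc (m + 1) →L[ℝ] Euc m × ℝ)) y :=
    ((ContinuousLinearMap.fst ℝ (Euc m) ℝ).comp
      (Φ : Euc (m + 1) →L[ℝ] Euc m × ℝ)).hasFDerivAt
  have h2 : HasFDerivAt (fun y => (Φ y).2)
      ((ContinuousLinearMap.snd ℝ (Euc m) ℝ).comp (Φ : Euc (m + 1) →L[ℝ] Euc m × ℝ)) y :=
    ((ContinuousLinearMap.snd ℝ (Euc m) ℝ).comp
      (Φ : Euc (m + 1) →L[ℝ] Euc m × ℝ)).hasFDerivAt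
  have hη : HasFDerivAt (tangentBump m) (fderiv ℝ (tangentBump m) (Φ y).1) (Φ y).1 :=
    (((tangentBump m).contDiff (n := 1)).differentiable (by simp) _).hasFDerivAt
  have hζ : HasFDerivAt normalBump (fderiv ℝ normalBump (Φ y).2) (Φ y).2 :=
    ((normalBump.contDiff (n := 1)).differentiable (by simp) _).hasFDerivAt
  have := (hη.comp y h1).mul (hζ.comp y h2)
  have h3 : fderiv ℝ (cylinderBump Φ) y = _ := this.fderiv
  rw [h3]
  simp [fderiv_eq_smul_deriv]
  ring

/-- Integration by parts for the model bump function in the half space `⟪n, y⟫ < 0`. -/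
lemma integral_halfSpace_fderiv_cylinderBump (hΦ : IsAdapted n Φ) (a : Euc (m + 1)) :
    ∫ y, {y | (Φ y).2 < 0}.indicator (fun y => fderiv ℝ (cylinderBump Φ) y a) y =
      (Φ a).2 * ∫ y, tangentBump m y := by
  set ζ0 : ℝ → ℝ := (Iio 0).indicator normalBump with hζ0
  set ζ1 : ℝ → ℝ := (Iio 0).indicator (deriv normalBump) with hζ1
  have hζc : ContDiff ℝ 1 normalBump := normalBump.contDiff
  have hηc : ContDiff ℝ 1 (tangentBump m) := (tangentBump m).contDiff
  have hηs := (tangentBump m).hasCompactSupport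
  have hζs := normalBump.hasCompactSupport
  have hi0 : Integrable ζ0 :=
    (hζc.continuous.integrable_of_hasCompactSupport hζs).indicator measurableSet_Iio
  have hi1 : Integrable ζ1 :=
    ((hζc.continuous_deriv le_rfl).integrable_of_hasCompactSupport hζs.deriv).indicator
      measurableSet_Iio
  have hj0 : Integrable fun y => fderiv ℝ (tangentBump m) y (Φ a).1 :=
    (contDiff_fderiv_apply hηc (m := 0) (by norm_num) _).continuous.integrable_of_hasCompactSupport
      (hηs.fderiv_apply (𝕜 := ℝ) _)
  have hj1 : Integrable (tangentBump m) := hηc.continuous.integrable_of_hasCompactSupport hηs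
  -- The boundary term: ∫ ζ' over (-∞, 0) is ζ(0) = 1. By Fubini the tangential derivative
  -- contributes 0.
  have hI1 : ∫ t, ζ1 t = 1 := by
    rw [hζ1, integral_indicator measurableSet_Iio, ← integral_Iic_eq_integral_Iio,
      hζs.integral_Iic_deriv_eq hζc]
    exact normalBump.one_of_mem_closedBall (by simp [normalBump])
  set F : Euc m × ℝ → ℝ := fun z => fderiv ℝ (tangentBump m) z.1 (Φ a).1 * ζ0 z.2 +
    (Φ a).2 * (tangentBump m z.1 * ζ1 z.2) with hF
  have hpt : ∀ y, {y | (Φ y).2 < 0}.indicator (fun y => fderiv ℝ (cylinderBump Φ) y a) y =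
      F (Φ y) := fun y => by
    by_cases hy : (Φ y).2 < 0
    · rw [indicator_of_mem (by exact hy), fderiv_cylinderBump, hF]
      simp only [hζ0, hζ1, indicator_of_mem (mem_Iio.2 hy)]
      ring
    · rw [indicator_of_notMem (by exact hy), hF]
      simp only [hζ0, hζ1, indicator_of_notMem (fun h => hy (mem_Iio.1 h))]
      ring
  simp_rw [hpt]
  rw [hΦ.measurePreserving.integral_comp Φ.toHomeomorph.measurableEmbedding F, hF,
    Measure.volume_eq_prod, integral_add (hj0.mul_prod hi0) ((hj1.mul_prod hi1).const_mul _),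
    integral_const_mul, integral_prod_mul,
    integral_prod_mul (fun y => fderiv ℝ (tangentBump m) y (Φ a).1),
    integral_fderiv_eq_zero hηc hηs, hI1]
  ring

/-- The factor r⁻¹ lowers the volume scaling r^(m+1) to r^m, the scaling of the boundary integral.
-/
lemma fderiv_scaledBump (r : ℝ) (x a : Euc (m + 1)) :
    fderiv ℝ (scaledBump Φ p r) x a = r⁻¹ * fderiv ℝ (cylinderBump Φ) (r⁻¹ • (x - p)) a := by
  have h1 : HasFDerivAt (fun x : Euc (m + 1) => r⁻¹ • (x - p))
      (r⁻¹ • ContinuousLinearMap.id ℝ (Euc (m + 1))) x :=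
    ((hasFDerivAt_id x).sub_const p).const_smul r⁻¹
  have h2 : HasFDerivAt (cylinderBump Φ) (fderiv ℝ (cylinderBump Φ) (r⁻¹ • (x - p)))
      (r⁻¹ • (x - p)) :=
    (contDiff_cylinderBump.differentiable (by simp) _).hasFDerivAt
  have h3 : fderiv ℝ (scaledBump Φ p r) x = _ := (h2.comp x h1).fderiv
  rw [h3]
  simp

/-- The rescaled domains converge to the half space at every y off the tangent hyperplane, which is
therefore shown to be null. -/
lemma ae_snd_ne_zero (hΦ : IsAdapted n Φ) : ∀ᵐ y, (Φ y).2 ≠ 0 := by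
  have h : ∀ᵐ z : Euc m × ℝ, z.2 ≠ 0 := by
    rw [Measure.volume_eq_prod]
    exact Measure.quasiMeasurePreserving_snd.ae (p := fun t : ℝ => t ≠ 0) (by simp [ae_iff])
  exact hΦ.measurePreserving.quasiMeasurePreserving.ae h

end HalfSpace

/-! ### Limits of the volume integrals. -/

namespace IsTubeWidth

variable {m : ℕ} {Ω : Set (Euc (m + 1))} {δ : ℝ} {p : Euc (m + 1)}
  {Φ : Euc (m + 1) ≃L[ℝ] Euc m × ℝ}

/-- Blow-up of the volume integral of the gradient of a rescaled bump function. -/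
lemma tendsto_integral_fderiv_scaledBump (hδ : IsTubeWidth Ω δ) (hΩ : IsOpen Ω)
    (hb : Bornology.IsBounded Ω) (hp : p ∈ frontier Ω) (hΦ : IsAdapted (outerNormal Ω p) Φ)
    {X : Euc (m + 1) → Euc (m + 1)} (hX : ContinuousOn X (closure Ω)) :
    Tendsto (fun r => (r ^ m)⁻¹ * ∫ x in Ω, fderiv ℝ (scaledBump Φ p r) x (X x)) (𝓝[>] (0 : ℝ))
      (𝓝 (⟪outerNormal Ω p, X p⟫_ℝ * ∫ y, tangentBump m y)) := by
  obtain ⟨B, hB⟩ := hb.isCompact_closure.exists_bound_of_continuousOn hX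
  have hpc : p ∈ closure Ω := frontier_subset_closure hp
  have hB0 : 0 ≤ B := (norm_nonneg _).trans (hB p hpc)
  have hD : Continuous (fderiv ℝ (cylinderBump Φ)) :=
    contDiff_cylinderBump.continuous_fderiv (by simp)
  have hDs : HasCompactSupport (fderiv ℝ (cylinderBump Φ)) :=
    (hasCompactSupport_cylinderBump hΦ).fderiv (𝕜 := ℝ)
  -- The integrand after substituting x = p + r y; dominated convergence then replaces the domain by
  -- the half space and X by X(p).
  set F : ℝ → Euc (m + 1) → ℝ := fun r y =>
    ((fun y => p + r • y) ⁻¹' Ω).indicator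
      (fun y => fderiv ℝ (cylinderBump Φ) y (X (p + r • y))) y with hF
  have hcont (r : ℝ) : Continuous fun y : Euc (m + 1) => p + r • y := by fun_prop
  have hlim : Tendsto (fun r => ∫ y, F r y) (𝓝[>] (0 : ℝ))
      (𝓝 (∫ y, {y | (Φ y).2 < 0}.indicator
        (fun y => fderiv ℝ (cylinderBump Φ) y (X p)) y)) := by
    refine tendsto_integral_filter_of_dominated_convergence
      (fun y => ‖fderiv ℝ (cylinderBump Φ) y‖ * B) ?_ ?_ ?_ ?_
    · refine Eventually.of_forall fun r => ?_
      have hpre : IsOpen ((fun y => p + r • y) ⁻¹' Ω) := hΩ.preimage (hcont r)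
      refine (aestronglyMeasurable_indicator_iff hpre.measurableSet).2
        (ContinuousOn.aestronglyMeasurable ?_ hpre.measurableSet)
      exact hD.continuousOn.clm_apply
        (hX.comp (hcont r).continuousOn fun y hy => subset_closure hy)
    · refine Eventually.of_forall fun r => Eventually.of_forall fun y => ?_
      rw [hF]
      by_cases hy : p + r • y ∈ Ω
      · simp only [indicator_of_mem (show y ∈ (fun y => p + r • y) ⁻¹' Ω from hy)]
        exact (ContinuousLinearMap.le_opNorm _ _).trans
          (by gcongr; exact hB _ (subset_closure hy))
      · simp only [indicator_of_notMem (show y ∉ (fun y => p + r • y) ⁻¹' Ω from hy), norm_zero]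
        positivity
    · exact ((hD.norm).integrable_of_hasCompactSupport hDs.norm).mul_const B
    · filter_upwards [ae_snd_ne_zero hΦ] with y hy
      rcases hy.lt_or_gt with hy | hy
      · rw [indicator_of_mem (show y ∈ {y | (Φ y).2 < 0} from hy)]
        have hin := hδ.eventually_add_smul_mem hΩ hp (w := y) (by rwa [← hΦ.snd_eq])
        have hXl : Tendsto (fun r : ℝ => X (p + r • y)) (𝓝[>] 0) (𝓝 (X p)) := by
          refine (hX p hpc).tendsto.comp (tendsto_nhdsWithin_iff.2 ⟨?_, ?_⟩)
          · have : ContinuousAt (fun r : ℝ => p + r • y) 0 := by fun_prop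
            simpa using this.tendsto.mono_left nhdsWithin_le_nhds
          · filter_upwards [hin] with r hr using subset_closure hr
        refine (((fderiv ℝ (cylinderBump Φ) y).continuous.tendsto _).comp hXl).congr' ?_
        filter_upwards [hin] with r hr
        simp only [hF, indicator_of_mem (show y ∈ (fun y => p + r • y) ⁻¹' Ω from hr),
          Function.comp_apply]
      · rw [indicator_of_notMem (show y ∉ {y | (Φ y).2 < 0} from not_lt.2 hy.le)]
        refine tendsto_const_nhds.congr' ?_
        filter_upwards [hδ.eventually_add_smul_notMem_closure hΩ hp (w := y)
          (by rwa [← hΦ.snd_eq])] with r hr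
        simp only [hF, indicator_of_notMem
          (show y ∉ (fun y => p + r • y) ⁻¹' Ω from fun h => hr (subset_closure h))]
  rw [integral_halfSpace_fderiv_cylinderBump hΦ, hΦ.snd_eq] at hlim
  refine hlim.congr' ?_
  filter_upwards [self_mem_nhdsWithin] with r hr
  have hr : 0 < r := hr
  have h1 := integral_comp_add_smul
    (Ω.indicator fun x => fderiv ℝ (cylinderBump Φ) (r⁻¹ • (x - p)) (X x)) hr p
  rw [integral_indicator hΩ.measurableSet] at h1
  simp_rw [fderiv_scaledBump]
  rw [integral_const_mul, ← mul_assoc, ← mul_inv, ← pow_succ, ← h1]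
  refine integral_congr_ae (Eventually.of_forall fun y => ?_)
  have hy : r⁻¹ • (p + r • y - p) = y := by
    rw [add_sub_cancel_left, smul_smul, inv_mul_cancel₀ hr.ne', one_smul]
  simp only [hF, indicator, hy]
  rfl

/-- Volume integrals of rescaled bump functions vanish to higher order. -/
lemma tendsto_integral_mul_scaledBump_volume (hΩ : IsOpen Ω)
    (hb : Bornology.IsBounded Ω) {n : Euc (m + 1)} (hΦ : IsAdapted n Φ)
    (hp : p ∈ closure Ω) {f : Euc (m + 1) → ℝ} (hf : ContinuousOn f (closure Ω)) :
    Tendsto (fun r => (r ^ m)⁻¹ * ∫ x in Ω, f x * scaledBump Φ p r x) (𝓝[>] (0 : ℝ)) (𝓝 0) := by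
  obtain ⟨B, hB⟩ := hb.isCompact_closure.exists_bound_of_continuousOn hf
  set C := ∫ y, cylinderBump Φ y with hC
  have hlin : Tendsto (fun r : ℝ => r * (B * C)) (𝓝[>] 0) (𝓝 0) := by
    have : ContinuousAt (fun r : ℝ => r * (B * C)) 0 := by fun_prop
    simpa using this.tendsto.mono_left nhdsWithin_le_nhds
  refine squeeze_zero_norm' ?_ hlin
  filter_upwards [self_mem_nhdsWithin] with r hr
  have hr : 0 < r := hr
  have hsc : ∫ x, scaledBump Φ p r x = r ^ (m + 1) * C := by
    have h1 := integral_comp_add_smul (scaledBump Φ p r) hr p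
    have h2 : ∀ y, scaledBump Φ p r (p + r • y) = cylinderBump Φ y := fun y => by
      rw [scaledBump, add_sub_cancel_left, smul_smul, inv_mul_cancel₀ hr.ne', one_smul]
    simp_rw [h2] at h1
    rw [hC, h1, mul_inv_cancel_left₀ (by positivity)]
  have hnn : ∀ x, 0 ≤ scaledBump Φ p r x := fun x => cylinderBump_nonneg _
  have hint : Integrable (scaledBump Φ p r) :=
    contDiff_scaledBump.continuous.integrable_of_hasCompactSupport
      (hasCompactSupport_scaledBump hΦ hr)
  have hle : ‖∫ x in Ω, f x * scaledBump Φ p r x‖ ≤ B * (r ^ (m + 1) * C) := by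
    rw [← hsc, ← integral_const_mul]
    refine (norm_integral_le_of_norm_le (hint.const_mul B).integrableOn ?_).trans
      (setIntegral_le_integral (hint.const_mul B) ?_)
    · filter_upwards [ae_restrict_mem hΩ.measurableSet] with x hx
      rw [norm_mul, Real.norm_of_nonneg (hnn x)]
      exact mul_le_mul_of_nonneg_right (hB x (subset_closure hx)) (hnn x)
    · exact Eventually.of_forall fun x => mul_nonneg ((norm_nonneg _).trans (hB p hp)) (hnn x)
  rw [norm_mul, norm_inv, norm_pow, Real.norm_of_nonneg hr.le, inv_mul_eq_div,
    div_le_iff₀ (by positivity)]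
  calc _ ≤ _ := hle
    _ = _ := by ring

end IsTubeWidth

/-! ### Weak gradients, traces and their classical counterparts. -/

section WeakGradient

variable {N : ℕ} {Ω : Set (Euc N)} {u φ : Euc N → ℝ} {G : Euc N → Euc N}

lemma tsupport_smul_subset_coeff {F : Type*} [NormedAddCommGroup F] [NormedSpace ℝ F]
    (φ : Euc N → ℝ) (g : Euc N → F) : tsupport (fun x => φ x • g x) ⊆ tsupport φ :=
  closure_mono fun _ hx h => hx (by simp [h])

lemma continuous_of_continuousOn_of_tsupport {F : Type*} [NormedAddCommGroup F] {g : Euc N → F}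
    (hΩ : IsOpen Ω) (hg : ContinuousOn g Ω) (hs : tsupport g ⊆ Ω) : Continuous g :=
  continuous_of_tsupport fun _ hx => hg.continuousAt (hΩ.mem_nhds (hs hx))

/-- A function that is smooth on an open set, multiplied by a test function, is smooth. -/
lemma contDiff_mul_of_isTestFunction (hΩ : IsOpen Ω) (hu : ContDiffOn ℝ 1 u Ω)
    (hφ : IsTestFunction Ω φ) : ContDiff ℝ 1 (fun x => φ x * u x) := by
  refine contDiff_iff_contDiffAt.2 fun x => ?_
  by_cases hx : x ∈ Ω
  · exact (hφ.contDiff.of_le (by norm_cast)).contDiffAt.mul (hu.contDiffAt (hΩ.mem_nhds hx))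
  · have hxs : x ∉ tsupport φ := fun h => hx (hφ.tsupport_subset h)
    refine (contDiffAt_const (c := (0 : ℝ))).congr_of_eventuallyEq ?_
    filter_upwards [notMem_tsupport_iff_eventuallyEq.1 hxs] with y hy
    simp [hy]

lemma continuousOn_gradient (hΩ : IsOpen Ω) (hu : ContDiffOn ℝ 1 u Ω) :
    ContinuousOn (gradient u) Ω :=
  (InnerProductSpace.toDual ℝ (Euc N)).symm.continuous.comp_continuousOn
    (hu.continuousOn_fderiv_of_isOpen hΩ le_rfl)

lemma tsupport_gradient_subset : tsupport (gradient φ) ⊆ tsupport φ := by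
  have h : Function.support (gradient φ) ⊆ Function.support (fderiv ℝ φ) := fun x hx h =>
    hx (by rw [gradient, h, map_zero])
  exact (closure_mono h).trans (tsupport_fderiv_subset ℝ)

lemma IsTestFunction.eq_zero (hφ : IsTestFunction Ω φ) {x : Euc N} (hx : x ∉ Ω) : φ x = 0 :=
  image_eq_zero_of_notMem_tsupport fun h => hx (hφ.tsupport_subset h)

lemma IsTestFunction.gradient_eq_zero (hφ : IsTestFunction Ω φ) {x : Euc N} (hx : x ∉ Ω) :
    gradient φ x = 0 :=
  image_eq_zero_of_notMem_tsupport fun h => hx (hφ.tsupport_subset (tsupport_gradient_subset h))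

lemma integrable_smul_gradient (hΩ : IsOpen Ω) (hu : ContDiffOn ℝ 1 u Ω)
    (hφ : IsTestFunction Ω φ) :
    Integrable (fun x => u x • gradient φ x) ∧ Integrable (fun x => φ x • gradient u x) := by
  have hsup : Function.support (fun x => u x • gradient φ x) ⊆ Function.support (gradient φ) :=
    fun x hx h => hx (by simp [h])
  have hs1 : tsupport (fun x => u x • gradient φ x) ⊆ tsupport φ :=
    (closure_mono hsup).trans tsupport_gradient_subset
  have hs2 := tsupport_smul_subset_coeff φ (gradient u)
  constructor
  · refine (continuous_of_continuousOn_of_tsupport hΩ ?_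
      (hs1.trans hφ.tsupport_subset)).integrable_of_hasCompactSupport
        (hφ.hasCompactSupport.of_isClosed_subset (isClosed_tsupport _) hs1)
    exact hu.continuousOn.smul
      (continuousOn_gradient hΩ (hφ.contDiff.of_le (by norm_cast)).contDiffOn)
  · refine (continuous_of_continuousOn_of_tsupport hΩ ?_
      (hs2.trans hφ.tsupport_subset)).integrable_of_hasCompactSupport
        (hφ.hasCompactSupport.of_isClosed_subset (isClosed_tsupport _) hs2)
    exact hφ.contDiff.continuous.continuousOn.smul (continuousOn_gradient hΩ hu)

/-- The classical gradient is a weak gradient. -/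
lemma integral_smul_gradient (hΩ : IsOpen Ω) (hu : ContDiffOn ℝ 1 u Ω)
    (hφ : IsTestFunction Ω φ) :
    ∫ x in Ω, u x • gradient φ x = -∫ x in Ω, φ x • gradient u x := by
  obtain ⟨hi1, hi2⟩ := integrable_smul_gradient hΩ hu hφ
  rw [setIntegral_eq_integral_of_forall_compl_eq_zero
      (fun x hx => by rw [hφ.gradient_eq_zero hx, smul_zero]),
    setIntegral_eq_integral_of_forall_compl_eq_zero
      (fun x hx => by rw [hφ.eq_zero hx, zero_smul]), eq_neg_iff_add_eq_zero,
    ← integral_add hi1 hi2]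
  -- Paired with a constant vector a, the integrand is the derivative of the compactly supported
  -- function φu along a.
  refine ext_inner_left ℝ fun a => ?_
  refine ((integral_inner (hi1.add hi2) a).symm.trans ?_).trans (inner_zero_right a).symm
  have hw := contDiff_mul_of_isTestFunction hΩ hu hφ
  have hws : HasCompactSupport fun x => φ x * u x := hφ.hasCompactSupport.mul_right
  refine Eq.trans (integral_congr_ae (Eventually.of_forall fun x => ?_))
    (integral_fderiv_eq_zero hw hws a)
  simp only [Pi.add_apply, inner_add_right, inner_smul_right, inner_gradient_right, conj_trivial]
  by_cases hx : x ∈ Ω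
  · have h1 : DifferentiableAt ℝ φ x := hφ.contDiff.differentiable (by simp) x
    have h2 : DifferentiableAt ℝ u x :=
      (hu.differentiableOn (by simp)).differentiableAt (hΩ.mem_nhds hx)
    rw [fderiv_fun_mul h1 h2]
    simp
    ring
  · have hxs : x ∉ tsupport φ := fun h => hx (hφ.tsupport_subset h)
    have h0 := notMem_tsupport_iff_eventuallyEq.1 hxs
    have h1 : (fun x => φ x * u x) =ᶠ[𝓝 x] fun _ => 0 := by
      filter_upwards [h0] with y hy
      simp [hy]
    rw [h0.fderiv_eq, h1.fderiv_eq, h0.eq_of_nhds]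
    simp

/-- The weak gradient of a function that is continuously differentiable in `Ω` is its classical
gradient. -/
lemma IsH1.ae_eq_gradient (hΩ : IsOpen Ω) (hb : Bornology.IsBounded Ω) (h : IsH1 Ω u G)
    (hu : ContDiffOn ℝ 1 u Ω) : ∀ᵐ x, x ∈ Ω → G x = gradient u x := by
  have hfin : IsFiniteMeasure (volume.restrict Ω) := ⟨by simpa using hb.measure_lt_top⟩
  have hG : IntegrableOn G Ω := h.memLp_grad.integrable (by norm_num)
  have hloc : LocallyIntegrableOn (fun x => G x - gradient u x) Ω :=
    hG.locallyIntegrableOn.sub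
      ((continuousOn_gradient hΩ hu).locallyIntegrableOn hΩ.measurableSet)
  have := hΩ.ae_eq_zero_of_integral_contDiff_smul_eq_zero hloc fun φ h1 h2 h3 => by
    have hφ : IsTestFunction Ω φ := ⟨h1, h2, h3⟩
    rw [← setIntegral_eq_integral_of_forall_compl_eq_zero
      (fun x hx => by rw [hφ.eq_zero hx, zero_smul] : ∀ x, x ∉ Ω → _)]
    simp_rw [smul_sub]
    obtain ⟨C, hC⟩ := h1.continuous.bounded_above_of_compact_support h2
    have hi : IntegrableOn (fun x => φ x • G x) Ω :=
      hG.bdd_smul C h1.continuous.aestronglyMeasurable (Eventually.of_forall hC)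
    rw [integral_sub hi (integrable_smul_gradient hΩ hu hφ).2.integrableOn, sub_eq_zero,
      ← neg_inj, ← integral_smul_gradient hΩ hu hφ, h.integral_by_parts φ hφ]
  filter_upwards [this] with x hx hxΩ
  exact sub_eq_zero.1 (hx hxΩ)

/-- Smooth functions with compact support belong to `H¹(Ω)`. -/
lemma isH1_of_contDiff (hΩ : IsOpen Ω) (hφ : ContDiff ℝ ∞ φ) (hs : HasCompactSupport φ) :
    IsH1 Ω φ (gradient φ) := by
  have h1 : ContDiff ℝ 1 φ := hφ.of_le (by norm_cast)
  have hg : Continuous (gradient φ) :=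
    (InnerProductSpace.toDual ℝ (Euc N)).symm.continuous.comp (h1.continuous_fderiv one_ne_zero)
  have hgs : HasCompactSupport (gradient φ) :=
    hs.of_isClosed_subset (isClosed_tsupport _) tsupport_gradient_subset
  exact ⟨hφ.continuous.memLp_of_hasCompactSupport hs, hg.memLp_of_hasCompactSupport hgs,
    fun _ hψ => integral_smul_gradient hΩ h1.contDiffOn hψ⟩

/-- The trace of a smooth function with compact support is its restriction. -/
lemma isTrace_of_contDiff (hφ : ContDiff ℝ ∞ φ) (hs : HasCompactSupport φ)
    [IsFiniteMeasure (surfaceMeasure Ω)] : IsTrace Ω φ (gradient φ) φ := by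
  obtain ⟨C, hC⟩ := hφ.continuous.bounded_above_of_compact_support hs
  refine ⟨MemLp.of_bound hφ.continuous.aestronglyMeasurable C (Eventually.of_forall hC),
    fun _ => φ, fun _ => hφ, ?_, ?_, ?_⟩ <;> simp

end WeakGradient

/-! ### From the weak to the pointwise Robin condition. -/

namespace IsTubeWidth

/-- The weak Robin condition implies the pointwise Robin condition. -/
lemma fderivWithin_outerNormal_of_mem {N : ℕ} {Ω : Set (Euc N)} {δ : ℝ} {β u : Euc N → ℝ}
    {p : Euc N} (hδ : IsTubeWidth Ω δ) (hΩ : IsOpen Ω) (hb : Bornology.IsBounded Ω)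
    (hβ : ContinuousOn β (frontier Ω)) (hu : u ∈ robinSmoothDomain Ω β) (hp : p ∈ frontier Ω) :
    fderivWithin ℝ u (closure Ω) p (outerNormal Ω p) = -(β p * u p) := by
  obtain ⟨⟨huc, G, f, hH1, hf, -, hweak⟩, hus⟩ := hu
  have hN := hδ.norm_outerNormal hp
  obtain _ | m := N
  -- In dimension 0 there is no unit vector, so N = m + 1 from here on.
  · rw [Subsingleton.elim (outerNormal Ω p) 0, norm_zero] at hN
    exact absurd hN zero_ne_one
  obtain ⟨Φ, hΦ⟩ := exists_isAdapted hN
  -- The gradient of u extended continuously to `closure Ω`; it equals `G` almost everywhere in Ω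
  -- and has a value at p.
  set X : Euc (m + 1) → Euc (m + 1) := fun x =>
    (InnerProductSpace.toDual ℝ (Euc (m + 1))).symm (fderivWithin ℝ u (closure Ω) x) with hX
  have hXc : ContinuousOn X (closure Ω) :=
    (InnerProductSpace.toDual ℝ (Euc (m + 1))).symm.continuous.comp_continuousOn
      (hus.continuousOn_fderivWithin (hδ.uniqueDiffOn_closure hΩ) (by norm_cast))
  have hGX : ∀ᵐ x, x ∈ Ω → G x = X x := by
    filter_upwards [hH1.ae_eq_gradient hΩ hb
      ((hus.of_le (by norm_cast)).mono subset_closure)] with x hx hxΩ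
    have : fderivWithin ℝ u (closure Ω) x = fderiv ℝ u x :=
      fderivWithin_of_mem_nhds (mem_of_superset (hΩ.mem_nhds hxΩ) subset_closure)
    simp only [hx hxΩ, hX, gradient, this]
  have hfin : IsFiniteMeasure (surfaceMeasure Ω) :=
    ⟨by simpa [surfaceMeasure] using hδ.surfaceMeasure_lt_top hb⟩
  have l1 := hδ.tendsto_integral_fderiv_scaledBump hΩ hb hp hΦ hXc
  have l2 := tendsto_integral_mul_scaledBump_volume hΩ hb hΦ (frontier_subset_closure hp) hf
  have l3 := hδ.tendsto_integral_mul_scaledBump hb hp hΦ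
    ((huc.mono frontier_subset_closure).mul hβ)
  -- For every r > 0 the three terms sum to r^(-m) times the weak identity, that is 0; so their
  -- limits sum to 0.
  have hlim := ((l1.add l2).add l3).congr' (f₂ := fun _ => (0 : ℝ)) (by
    filter_upwards [self_mem_nhdsWithin] with r hr
    have hs := hasCompactSupport_scaledBump (p := p) hΦ hr
    have h := hweak _ _ _ (isH1_of_contDiff hΩ contDiff_scaledBump hs)
      (isTrace_of_contDiff contDiff_scaledBump hs)
    have e1 : ∫ x in Ω, ⟪G x, gradient (scaledBump Φ p r) x⟫_ℝ =
        ∫ x in Ω, fderiv ℝ (scaledBump Φ p r) x (X x) := by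
      refine setIntegral_congr_ae hΩ.measurableSet ?_
      filter_upwards [hGX] with x hx hxΩ
      rw [inner_gradient_right, hx hxΩ, conj_trivial]
    have e3 : ∫ x, scaledBump Φ p r x * (u x * β x) ∂(surfaceMeasure Ω) =
        ∫ x, u x * scaledBump Φ p r x * β x ∂(surfaceMeasure Ω) := by
      congr 1
      ext x
      ring
    rw [e1] at h
    rw [← mul_add, ← mul_add]
    refine mul_eq_zero_of_right _ ?_
    rw [← h, ← e3]
    rfl)
  have heq := tendsto_nhds_unique hlim tendsto_const_nhds
  have hc : 0 < ∫ y, tangentBump m y := integral_tangentBump_pos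
  have hXp : ⟪outerNormal Ω p, X p⟫_ℝ = fderivWithin ℝ u (closure Ω) p (outerNormal Ω p) := by
    rw [real_inner_comm, hX, InnerProductSpace.toDual_symm_apply]
  rw [hXp] at heq
  have h0 : (fderivWithin ℝ u (closure Ω) p (outerNormal Ω p) + β p * u p) *
      ∫ y, tangentBump m y = 0 := by
    rw [← heq]
    simp only [Pi.mul_apply]
    ring
  exact eq_neg_of_add_eq_zero_left ((mul_eq_zero.1 h0).resolve_right hc.ne')

end IsTubeWidth

end

/-- The operator `E_β` maps `D = D(Δ_R) ∩ C^∞(Ω̄)` into `D(Δ_0)`. -/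
theorem theorem3p7 {N : ℕ} (Ω : Set (Euc N)) (hΩ : IsSmoothBoundedOpen Ω)
    (β : Euc N → ℝ) (hβ : ContDiffOn ℝ ∞ β (frontier Ω)) (hβ_nonneg : ∀ z ∈ frontier Ω, 0 ≤ β z)
    (δ : ℝ) (hδ : IsTubeWidth Ω δ) (ρ₁ : ℝ → ℝ → ℝ) (hρ₁ : IsKinkProfile δ ρ₁)
    (u : Euc N → ℝ) (hu : u ∈ robinSmoothDomain Ω β) :
    ∃ v ∈ laplacianZeroDomain N, (v : Euc N → ℝ) = robinExtension Ω δ ρ₁ β u :=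
  mem_laplacianZeroDomain_of_contDiff
    (hδ.contDiff_two_robinExtension hΩ.isOpen hΩ.isBounded hρ₁ hβ_nonneg hβ hu.2 fun _ hp =>
      hδ.fderivWithin_outerNormal_of_mem hΩ.isOpen hΩ.isBounded hβ.continuousOn hu hp)
    (hδ.hasCompactSupport_robinExtension hΩ.isBounded hρ₁ hβ_nonneg)
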